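/- For $n\in\mathbb{N}=\{1,2,3,\dots\}$ let $C_n\subseteq\mathbb{R}^2$ be the circle of radius $\frac1n$ centered at $(\frac1n,0)$, let $\mathbb{H}=\bigcup_{i\ge 1}C_i\subseteq\mathbb{R}^2$ be the Hawaiian Earring with basepoint $b_0=(0,0)$, put $\mathbb{H}_k=\bigcup_{i\ge k}C_i$, and let $\ell_n:[0,1]\to C_n$ be the loop $\ell_n(t)=\left(\frac1n(1-\cos 2\pi t),\frac1n\sin 2\pi t\right)$. For each $n$ let $P_n=D_n\setminus(D_{n,1}^\circ\cup D_{n,2}^\circ)$ be a pair of pants, where $D_{n,1},D_{n,2}$ are disjoint closed disks in the interior of a closed disk $D_n\subseteq\mathbb{R}^2$, and let $\alpha_n,\beta_n,\gamma_n:[0,1]\to P_n$ be clockwise parametrizations of $\partial D_n,\partial D_{n,1},\partial D_{n,2}$. Let $\mathbb{P}=\mathbb{H}\cup_f\coprod_{n}P_n$ be the adjunction space (with the quotient topology) obtained from $\mathbb{H}$ by attaching all $P_n$ along the maps $f_n:\partial P_n\to\mathbb{H}$ with $f_n\circ\alpha_n=\ell_n$, $f_n\circ\beta_n=\ell_{2n}$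 and $f_n\circ\gamma_n=\ell_{2n+1}$. The loops $\ell_n$ are also regarded as loops in $\mathbb{P}$ based at (the image of) $b_0$. A group $G$ is called n-slender (noncommutatively slender) if for every homomorphism $h:\pi_1(\mathbb{H},b_0)\to G$ there is a $k\in\mathbb{N}$ such that $h([\alpha])=1$ for all loops $\alpha$ in $\mathbb{H}_k$ based at $b_0$. A group $G$ is called residually n-slender (respectively residually free) if for every $1\ne g\in G$ there are an n-slender (respectively free) group $S$ and a homomorphism $h:G\to S$ with $h(g)\neq 1$. **Proposition.** In $\pi_1(\mathbb{P},b_0)$ we have $[\ell_1]\neq 1$, but $h([\ell_1])=1$ for every homomorphism $h:\pi_1(\mathbb{P},b_0)\to S$ to an n-slender group $S$. In particular, $\pi_1(\mathbb{P},b_0)$ is not residually n-slender. Moreover, $\pi_1(\mathbb{P},b_0)$ is not residually free. -/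

import Mathlib

universe u v w

noncomputable section

namespace HawaiianPants

open Complex

/-! ### The Hawaiian Earring

The plane `ℝ²` is identified with `ℂ`; indices `n = 1, 2, 3, …` are taken in `ℕ+`. -/

/-- The circle `C_n` of radius `1/n` centered at `(1/n, 0)`. -/
def circle (n : ℕ+) : Set ℂ := Metric.sphere (1 / (n : ℂ)) (1 / (n : ℝ))

/-- The Hawaiian Earring `ℍ = ⋃ C_i`, as a subset of the plane. -/
def earringSet : Set ℂ := ⋃ i : ℕ+, circle i

/-- The Hawaiian Earring as a space (with the subspace topology). -/
abbrev Earring : Type := earringSet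

theorem zero_mem_circle (n : ℕ+) : (0 : ℂ) ∈ circle n := by
  simp [circle]

/-- The basepoint `b₀ = (0, 0)` of the Hawaiian Earring. -/
def earringBase : Earring := ⟨0, Set.mem_iUnion.2 ⟨1, zero_mem_circle 1⟩⟩

/-- The subset `ℍ_k = ⋃_{i ≥ k} C_i` of the Hawaiian Earring. -/
def earringTail (k : ℕ+) : Set Earring := {x | ∃ i : ℕ+, k ≤ i ∧ (x : ℂ) ∈ circle i}

/-- The point `(1/n) (1 - exp (-2πit)) = ((1/n) (1 - cos 2πt), (1/n) sin 2πt)`. -/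
def loopPoint (n : ℕ+) (t : ℝ) : ℂ :=
  1 / (n : ℂ) * (1 - exp (-(2 * Real.pi * t * I)))

theorem loopPoint_re (n : ℕ+) (t : ℝ) :
    (loopPoint n t).re = 1 / (n : ℝ) * (1 - Real.cos (2 * Real.pi * t)) := by
  have h : (1 / (n : ℂ)) = ((1 / (n : ℝ) : ℝ) : ℂ) := by push_cast; rfl
  rw [loopPoint, h, Complex.re_ofReal_mul]
  simp [exp_re]

theorem loopPoint_im (n : ℕ+) (t : ℝ) :
    (loopPoint n t).im = 1 / (n : ℝ) * Real.sin (2 * Real.pi * t) := by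
  have h : (1 / (n : ℂ)) = ((1 / (n : ℝ) : ℝ) : ℂ) := by push_cast; rfl
  rw [loopPoint, h, Complex.im_ofReal_mul]
  simp [exp_im]

theorem norm_exp_turn (t : ℝ) : ‖exp (-(2 * Real.pi * t * I))‖ = 1 := by
  have h : -(2 * Real.pi * t * I) = ((-(2 * Real.pi * t) : ℝ) : ℂ) * I := by
    push_cast; ring
  rw [h, norm_exp_ofReal_mul_I]

theorem exp_turn_one : exp (-(2 * Real.pi * ((1 : ℝ) : ℂ) * I)) = 1 := by
  rw [exp_neg]; simp [exp_two_pi_mul_I]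

theorem loopPoint_mem_circle (n : ℕ+) (t : ℝ) : loopPoint n t ∈ circle n := by
  have h : loopPoint n t - 1 / (n : ℂ) = -(1 / (n : ℂ) * exp (-(2 * Real.pi * t * I))) := by
    rw [loopPoint]; ring
  rw [circle, mem_sphere_iff_norm, h, norm_neg, norm_mul, norm_exp_turn]
  simp

/-- The loop `ℓ_n` in `ℍ`, running once around `C_n`. -/
def earringLoop (n : ℕ+) : Path earringBase earringBase where
  toFun t := ⟨loopPoint n t, Set.mem_iUnion.2 ⟨n, loopPoint_mem_circle n t⟩⟩
  continuous_toFun := by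
    refine Continuous.subtype_mk ?_ _
    unfold loopPoint
    fun_prop
  source' := by
    apply Subtype.ext
    simp [loopPoint, earringBase]
  target' := by
    apply Subtype.ext
    have h := exp_turn_one
    simp only [ofReal_one, mul_one] at h
    simp [loopPoint, earringBase, h]

/-! ### Pairs of pants -/

/-- The pair of pants `D ∖ (D₁° ∪ D₂°)`, where `D` is the disk of radius `4` around `0` and
`D₁`, `D₂` are the disks of radius `1` around `2i` and `-2i`. -/
def pantsSet : Set ℂ :=
  Metric.closedBall 0 4 \ (Metric.ball (2 * I) 1 ∪ Metric.ball (-2 * I) 1)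

/-- The pair of pants as a space. -/
abbrev Pants : Type := pantsSet

/-- The boundary `∂D ∪ ∂D₁ ∪ ∂D₂` of the pair of pants. -/
def pantsBoundary : Set Pants :=
  {z | (z : ℂ) ∈ Metric.sphere (0 : ℂ) 4 ∪ Metric.sphere (2 * I) 1 ∪ Metric.sphere (-2 * I) 1}

/-- The similarity of the plane which takes the circle of radius `r` around `c` to `C_m`
and its leftmost point `c - r` to `b₀`. -/
def toCircle (c : ℂ) (r : ℝ) (m : ℕ+) (z : ℂ) : ℂ := 1 / (m : ℂ) * (1 + (z - c) / r)

theorem toCircle_mem {c : ℂ} {r : ℝ} (hr : 0 < r) (m : ℕ+) {z : ℂ}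
    (hz : z ∈ Metric.sphere c r) : toCircle c r m z ∈ circle m := by
  have h : toCircle c r m z - 1 / (m : ℂ) = 1 / (m : ℂ) * ((z - c) / r) := by
    rw [toCircle]; ring
  rw [mem_sphere_iff_norm] at hz
  rw [circle, mem_sphere_iff_norm, h, norm_mul, norm_div (z - c), hz]
  simp [abs_of_pos hr, hr.ne']

open Classical in
/-- The attaching map `f_n : ∂P_n → ℍ`, as a point of the plane: it takes `∂D` to `C_n`,
`∂D₁` to `C_{2n}`, and `∂D₂` to `C_{2n+1}`. -/
def attachPoint (n : ℕ+) (z : ℂ) : ℂ :=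
  if z ∈ Metric.sphere (0 : ℂ) 4 then toCircle 0 4 n z
  else if z ∈ Metric.sphere (2 * I) 1 then toCircle (2 * I) 1 (2 * n) z
  else toCircle (-2 * I) 1 (2 * n + 1) z

theorem attachPoint_mem (n : ℕ+) (z : pantsBoundary) : attachPoint n (z : Pants) ∈ earringSet := by
  unfold attachPoint
  split_ifs with h1 h2
  · exact Set.mem_iUnion.2 ⟨_, toCircle_mem (by norm_num) _ h1⟩
  · exact Set.mem_iUnion.2 ⟨_, toCircle_mem (by norm_num) _ h2⟩
  · have h3 : ((z : Pants) : ℂ) ∈ Metric.sphere (-2 * I) 1 := by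
      rcases z.2 with (h | h) | h
      · exact absurd h h1
      · exact absurd h h2
      · exact h
    exact Set.mem_iUnion.2 ⟨_, toCircle_mem (by norm_num) _ h3⟩

/-- The attaching map `f_n : ∂P_n → ℍ`. -/
def attach (n : ℕ+) (z : pantsBoundary) : Earring :=
  ⟨attachPoint n (z : Pants), attachPoint_mem n z⟩

/-- The clockwise parametrization of the circle of radius `r` around `c`, which starts at the
leftmost point of that circle. -/
def clockwise (c : ℂ) (r : ℝ) (t : ℝ) : ℂ := c - r * exp (-(2 * Real.pi * t * I))

theorem clockwise_mem (c : ℂ) {r : ℝ} (hr : 0 ≤ r) (t : ℝ) :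
    clockwise c r t ∈ Metric.sphere c r := by
  rw [mem_sphere_iff_norm, clockwise, sub_sub_cancel_left, norm_neg, norm_mul, norm_exp_turn]
  simp [abs_of_nonneg hr]

theorem toCircle_clockwise (c : ℂ) {r : ℝ} (hr : 0 < r) (m : ℕ+) (t : ℝ) :
    toCircle c r m (clockwise c r t) = loopPoint m t := by
  have : (r : ℂ) ≠ 0 := by exact_mod_cast hr.ne'
  rw [toCircle, clockwise, loopPoint]
  field_simp
  ring

/-- `f_n ∘ α_n = ℓ_n`. -/
theorem attachPoint_outer (n : ℕ+) (t : ℝ) :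
    attachPoint n (clockwise 0 4 t) = loopPoint n t := by
  rw [attachPoint, if_pos (clockwise_mem 0 (by norm_num) t)]
  exact_mod_cast toCircle_clockwise 0 (r := 4) (by norm_num) n t

theorem not_mem_of_norm_sub {c z : ℂ} (hc : ‖c‖ = 2) (hz : z ∈ Metric.sphere c 1) :
    z ∉ Metric.sphere (0 : ℂ) 4 := by
  intro h
  rw [mem_sphere_iff_norm] at h hz
  have := norm_sub_norm_le z c
  rw [sub_zero] at h
  linarith

/-- `f_n ∘ β_n = ℓ_{2n}`. -/
theorem attachPoint_inner_one (n : ℕ+) (t : ℝ) :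
    attachPoint n (clockwise (2 * I) 1 t) = loopPoint (2 * n) t := by
  have h := clockwise_mem (2 * I) (r := 1) (by norm_num) t
  rw [attachPoint, if_neg (not_mem_of_norm_sub (by simp) h), if_pos h]
  exact toCircle_clockwise (2 * I) (r := 1) (by norm_num) (2 * n) t

/-- `f_n ∘ γ_n = ℓ_{2n+1}`. -/
theorem attachPoint_inner_two (n : ℕ+) (t : ℝ) :
    attachPoint n (clockwise (-2 * I) 1 t) = loopPoint (2 * n + 1) t := by
  have h := clockwise_mem (-2 * I) (r := 1) (by norm_num) t
  have h2 : clockwise (-2 * I) 1 t ∉ Metric.sphere (2 * I) 1 := by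
    intro h'
    rw [mem_sphere_iff_norm] at h h'
    have h4 : ‖(4 * I : ℂ)‖ = 4 := by simp
    have := norm_sub_le (clockwise (-2 * I) 1 t - -2 * I) (clockwise (-2 * I) 1 t - 2 * I)
    rw [h, h', show clockwise (-2 * I) 1 t - -2 * I - (clockwise (-2 * I) 1 t - 2 * I) = 4 * I by
      ring, h4] at this
    norm_num at this
  rw [attachPoint, if_neg (not_mem_of_norm_sub (by simp) h), if_neg h2]
  exact toCircle_clockwise (-2 * I) (r := 1) (by norm_num) (2 * n + 1) t

/-! ### Adjunction spaces and the Hawaiian Pants -/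

/-- The adjunction space `X ∪_f Y`, obtained from the disjoint union of `X` and `Y` by
identifying every `a ∈ A ⊆ Y` with `f a ∈ X`. -/
def AdjunctionSpace {X : Type u} {Y : Type v} (A : Set Y) (f : A → X) : Type (max u v) :=
  Quot fun p q : X ⊕ Y => ∃ a : A, p = Sum.inr (a : Y) ∧ q = Sum.inl (f a)

/-- The quotient topology. -/
instance {X : Type u} {Y : Type v} [TopologicalSpace X] [TopologicalSpace Y] (A : Set Y)
    (f : A → X) : TopologicalSpace (AdjunctionSpace A f) :=
  inferInstanceAs (TopologicalSpace (Quot _))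

/-- The boundary `∐ ∂P_n` of the disjoint union `∐ P_n`. -/
def coprodBoundary : Set (Σ _ : ℕ+, Pants) := {p | p.2 ∈ pantsBoundary}

/-- The map `f : ∐ ∂P_n → ℍ` which is `f_n` on `∂P_n`. -/
def coprodAttach (p : coprodBoundary) : Earring := attach p.1.1 ⟨p.1.2, p.2⟩

/-- The Hawaiian Pants `ℙ = ℍ ∪_f ∐ P_n`. -/
abbrev HPants : Type := AdjunctionSpace coprodBoundary coprodAttach

/-- The canonical map `ι : ℍ → ℙ`. -/
def incl : C(Earring, HPants) where
  toFun x := Quot.mk _ (Sum.inl x)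
  continuous_toFun := continuous_quot_mk.comp continuous_inl

/-- The basepoint `b₀` of `ℙ`. -/
def base : HPants := incl earringBase

/-- The loop `ℓ_n` in `ℙ`. -/
def pantsLoop (n : ℕ+) : Path base base := (earringLoop n).map incl.continuous

/-! ### Residual properties of groups -/

/-- The class `[α]` of a loop `α` in the fundamental group. -/
def loopClass {X : Type u} [TopologicalSpace X] {x : X} (α : Path x x) : FundamentalGroup X x :=
  FundamentalGroup.fromPath (Path.Homotopic.Quotient.mk α)

/-- Noncommutatively slender groups: for every homomorphism `h : π₁(ℍ, b₀) → G` there is a `k`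
such that `h` kills the classes of all loops in `ℍ_k`. -/
def IsNSlender (G : Type u) [Group G] : Prop :=
  ∀ h : FundamentalGroup Earring earringBase →* G,
    ∃ k : ℕ+, ∀ α : Path earringBase earringBase,
      (∀ t, α t ∈ earringTail k) → h (loopClass α) = 1

/-- Residually n-slender groups (tested on n-slender groups `S` in the universe `v`). -/
def IsResiduallyNSlender (G : Type w) [Group G] : Prop :=
  ∀ g : G, g ≠ 1 → ∃ (S : Type v) (_ : Group S), IsNSlender S ∧ ∃ h : G →* S, h g ≠ 1

/-- Residually free groups (tested on free groups `S` in the universe `v`). -/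
def IsResiduallyFree (G : Type w) [Group G] : Prop :=
  ∀ g : G, g ≠ 1 → ∃ (S : Type v) (_ : Group S), IsFreeGroup S ∧ ∃ h : G →* S, h g ≠ 1

end HawaiianPants

end

/-! The vanishing claims rest on one relation: inside $P_n$ the outer boundary is a product of
conjugates of powers of the two inner ones, so a homomorphism which kills $\ell_{2n}$ and
$\ell_{2n+1}$ kills $\ell_n$ (`map_pantsLoop_eq_one`). A homomorphism which kills almost all
$\ell_n$ therefore kills all of them, by descent to smaller indices. For an n-slender target, the
restriction to $\pi_1(\mathbb{H})$ kills almost all $\ell_n$ by definition.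

For a free target the same is proved directly, following Higman. Infinite concatenation in
$\mathbb{H}$ produces loops with $x_k = \ell_{k+1}\cdot x_{k+1}^{m_k}$ for any prescribed exponents
(`Path.exists_nested_concat`). In a free group, word length allows such a system with fast growing
$m_k$ only if almost all $\ell_k$ are killed (`FreeGroup.eventually_eq_one_of_pow_mul`).

For $[\ell_1]\ne 1$: a null-homotopy has compact image, so it meets the interiors of only finitely
many $P_n$. It then suffices to follow the branch $\ell_1,\ell_2,\ell_4,\dots$ up to a finite stage
$J$. Map $\mathbb{H}$ to the punctured plane by winding $C_{2^j}$, $j\le J$, once around the origin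
and making all other circles constant. This extends over $P_n$ for $n<2^J$, because either $\partial
D$ and $\partial D_1$ wind once and $\partial D_2$ is constant, or all three are constant. The loop
$\ell_1$ goes to a generator of the fundamental group of the circle. Winding all $C_{2^j}$ at once
would be discontinuous at $b_0$, which is why compactness is needed. -/

/-! ### Word length of powers in free groups -/

namespace FreeGroup

variable {α : Type*} [DecidableEq α]

/-- Write $x = c r c^{-1}$ with $r$ cyclically reduced; then $c r^{n+1} c^{-1}$ is already a reduced
word. -/
theorem norm_pow_succ (x : FreeGroup α) (n : ℕ) :
    norm (x ^ (n + 1)) = 2 * (reduceCyclically.conjugator x.toWord).length +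
      (n + 1) * (reduceCyclically x.toWord).length := by
  rw [norm, toWord_pow, reduceCyclically.reduce_flatten_replicate_succ isReduced_toWord]
  simp [invRev_length]
  ring

theorem reduceCyclically_toWord_length_pos {x : FreeGroup α} (hx : x ≠ 1) :
    0 < (reduceCyclically x.toWord).length := by
  rw [List.length_pos_iff]
  intro h
  apply hx
  have h1 := reduceCyclically.conj_conjugator_reduceCyclically x.toWord
  rw [h, List.append_nil] at h1
  rw [← mk_toWord (x := x), ← h1, ← mul_mk, ← inv_mk, mul_inv_cancel]

theorem le_norm_pow {x : FreeGroup α} (hx : x ≠ 1) (n : ℕ) : n ≤ norm (x ^ n) := by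
  rcases n with _ | n
  · simp
  · have := reduceCyclically_toWord_length_pos hx
    rw [norm_pow_succ]
    nlinarith

theorem norm_le_norm_pow_succ (x : FreeGroup α) (n : ℕ) : norm x ≤ norm (x ^ (n + 1)) := by
  have h := norm_pow_succ x 0
  rw [zero_add, pow_one] at h
  rw [h, norm_pow_succ]
  nlinarith [Nat.zero_le (n * (reduceCyclically x.toWord).length)]

/-- A solution of an infinite system `x k = x (k + 1) ^ m k * g k` in a free group, with exponents
that grow fast with respect to the `g k`, forces almost all `g k` to be trivial. -/
theorem eventually_eq_one_of_pow_mul (g x : ℕ → FreeGroup α)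
    (h : ∀ k, x k = x (k + 1) ^ (k + ∑ i ∈ Finset.range (k + 1), norm (g i) + 1) * g k) :
    ∃ K, ∀ k ≥ K, g k = 1 := by
  set m : ℕ → ℕ := fun k ↦ k + ∑ i ∈ Finset.range (k + 1), norm (g i) with hm
  have hpow (k : ℕ) : norm (x (k + 1) ^ (m k + 1)) ≤ norm (x k) + norm (g k) := by
    have : x (k + 1) ^ (m k + 1) = x k * (g k)⁻¹ := by rw [h k, mul_inv_cancel_right]
    rw [this]
    exact (norm_mul_le _ _).trans_eq (by rw [norm_inv_eq])
  -- Passing to a positive power does not shorten a word, so $|x_{k+1}| \le |x_k| + |g_k|$.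
  have hx (k : ℕ) : norm (x k) ≤ norm (x 0) + ∑ i ∈ Finset.range k, norm (g i) := by
    induction k with
    | zero => simp
    | succ k ih =>
      rw [Finset.sum_range_succ]
      have := (norm_le_norm_pow_succ (x (k + 1)) (m k)).trans (hpow k)
      omega
  -- If $x_{k+1}\ne 1$, its power has length at least the exponent. The sum in the exponent cancels
  -- the bound on $|x_k|+|g_k|$, which leaves $k+1\le|x_0|$.
  have hone (k : ℕ) (hk : norm (x 0) ≤ k) : x (k + 1) = 1 := by
    by_contra hne
    have h1 := (le_norm_pow hne (m k + 1)).trans (hpow k)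
    have h2 := hx k
    simp only [hm, Finset.sum_range_succ] at h1
    omega
  -- The shift by one makes both $x_k$ and $x_{k+1}$ trivial in the equation for $g_k$.
  refine ⟨norm (x 0) + 1, fun k hk ↦ ?_⟩
  obtain ⟨k, rfl⟩ : ∃ j, k = j + 1 := ⟨k - 1, by omega⟩
  have := h (k + 1)
  rw [hone k (by omega), hone (k + 1) (by omega), one_pow, one_mul] at this
  exact this.symm

end FreeGroup

/-! ### Infinite nested concatenation of shrinking loops -/

open Filter Topology unitInterval

/-- The `n`-fold concatenation of a loop. -/
noncomputable def Path.concatPow {X : Type*} [TopologicalSpace X] {b : X} (p : Path b b) : ℕ → Path b b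
  | 0 => Path.refl b
  | n + 1 => p.trans (p.concatPow n)

namespace Path

section Topological

variable {X : Type*} [TopologicalSpace X] {b : X}

theorem continuous_concatPow (n : ℕ) : Continuous fun p : Path b b ↦ p.concatPow n := by
  induction n with
  | zero => exact continuous_const
  | succ n ih => exact continuous_id.path_trans ih

end Topological

section Metric

variable {X : Type*} [MetricSpace X] {b : X}

theorem dist_trans_le {p p' q q' : Path b b} {C : ℝ} (hp : ∀ t, dist (p t) (p' t) ≤ C)
    (hq : ∀ t, dist (q t) (q' t) ≤ C) (t : I) : dist (p.trans q t) (p'.trans q' t) ≤ C := by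
  rw [trans_apply, trans_apply]
  split_ifs
  · exact hp _
  · exact hq _

theorem dist_concatPow_le {p p' : Path b b} {C : ℝ} (hC : 0 ≤ C) (hp : ∀ t, dist (p t) (p' t) ≤ C)
    (n : ℕ) (t : I) : dist (p.concatPow n t) (p'.concatPow n t) ≤ C := by
  induction n generalizing t with
  | zero => simpa [concatPow] using hC
  | succ n ih => exact dist_trans_le hp ih t

/-- The approximations to a solution of `x k = l k ⬝ x (k + 1) ^ m k`. -/
noncomputable def nestedApprox (l : ℕ → Path b b) (m : ℕ → ℕ) : ℕ → ℕ → Path b b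
  | 0, _ => Path.refl b
  | j + 1, k => (l k).trans ((nestedApprox l m j (k + 1)).concatPow (m k))

theorem refl_concatPow (n : ℕ) : (Path.refl b).concatPow n = Path.refl b := by
  induction n with
  | zero => rfl
  | succ n ih => rw [concatPow, ih, refl_trans_refl]

variable {l : ℕ → Path b b} {m : ℕ → ℕ} {r : ℕ → ℝ}

theorem dist_nestedApprox_base_le (hr : Antitone r) (hr0 : ∀ k, 0 ≤ r k)
    (hl : ∀ k t, dist (l k t) b ≤ r k) (j k : ℕ) (t : I) :
    dist (nestedApprox l m j k t) b ≤ r k := by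
  induction j generalizing k t with
  | zero => simpa [nestedApprox] using hr0 k
  | succ j ih =>
    have h := dist_trans_le (p' := Path.refl b) (q' := Path.refl b) (hl k)
      (q := (nestedApprox l m j (k + 1)).concatPow (m k)) (fun s ↦ ?_) t
    · rw [refl_trans_refl] at h
      exact h
    · rw [← refl_concatPow (m k)]
      exact dist_concatPow_le (hr0 k) (fun u ↦ (ih (k + 1) u).trans (hr k.le_succ)) _ s

/-- The two approximations agree except where the shorter one stops, at depth `j`. There it is
constant, while the other stays within `r (k + j)` of the base point. -/
theorem dist_nestedApprox_le (hr : Antitone r) (hr0 : ∀ k, 0 ≤ r k)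
    (hl : ∀ k t, dist (l k t) b ≤ r k) (j i k : ℕ) (t : I) :
    dist (nestedApprox l m j k t) (nestedApprox l m (j + i) k t) ≤ r (k + j) := by
  induction j generalizing k t with
  | zero =>
    rw [dist_comm]
    exact dist_nestedApprox_base_le hr hr0 hl (0 + i) k t
  | succ j ih =>
    rw [Nat.succ_add_eq_add_succ j i]
    refine dist_trans_le (fun _ ↦ by simpa using hr0 _)
      (dist_concatPow_le (hr0 _) (fun s ↦ ?_) _) t
    have h := ih (k + 1) s
    rwa [add_right_comm, add_assoc] at h

/-- Loops which shrink to the base point can be concatenated to solve an infinite system of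
equations `x k = l k ⬝ x (k + 1) ^ m k`. -/
theorem exists_nested_concat [CompleteSpace X] (hr : Antitone r) (hr0 : Tendsto r atTop (𝓝 0))
    (hl : ∀ k t, dist (l k t) b ≤ r k) (m : ℕ → ℕ) :
    ∃ x : ℕ → Path b b, ∀ k, x k = (l k).trans ((x (k + 1)).concatPow (m k)) := by
  have hr1 : ∀ k, 0 ≤ r k := fun k ↦ hr.le_of_tendsto hr0 k
  have hlim (k : ℕ) : ∃ x : Path b b, Tendsto (fun j ↦ nestedApprox l m j k) atTop (𝓝 x) := by
    have hc : CauchySeq fun j ↦ (nestedApprox l m j k : C(I, X)) := by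
      refine cauchySeq_of_le_tendsto_0' (fun j ↦ r (k + j)) (fun j i hji ↦ ?_)
        (by simpa only [add_comm] using (tendsto_add_atTop_iff_nat k).2 hr0)
      obtain ⟨i, rfl⟩ := Nat.exists_eq_add_of_le hji
      exact (ContinuousMap.dist_le (hr1 _)).2 (dist_nestedApprox_le hr hr1 hl j i k)
    obtain ⟨f, hf⟩ := cauchySeq_tendsto_of_complete hc
    have heval (t : I) : Tendsto (fun j ↦ nestedApprox l m j k t) atTop (𝓝 (f t)) :=
      ((continuous_eval_const t : Continuous fun g : C(I, X) ↦ g t).tendsto f).comp hf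
    have h0 : f 0 = b := tendsto_nhds_unique (heval 0) (by simp)
    have h1 : f 1 = b := tendsto_nhds_unique (heval 1) (by simp)
    refine ⟨⟨f, h0, h1⟩, ?_⟩
    rw [nhds_induced, tendsto_comap_iff]
    exact hf
  choose x hx using hlim
  -- The recursion for the approximations is an equality of parametrized paths, and concatenation is
  -- continuous, so it survives in the limit without any homotopy.
  refine ⟨x, fun k ↦ Path.ext (funext fun t ↦ ?_)⟩
  have heval : Continuous fun p : Path b b ↦ p t := continuous_eval_const t
  refine tendsto_nhds_unique ((heval.tendsto _).comp ((tendsto_add_atTop_iff_nat 1).2 (hx k))) ?_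
  exact ((heval.comp (continuous_const.path_trans (continuous_concatPow (m k)))).tendsto _).comp
    (hx (k + 1))

end Metric

end Path

/-! ### Homomorphisms from the group of the Hawaiian Earring to free groups -/

namespace HawaiianPants

theorem loopClass_trans {X : Type*} [TopologicalSpace X] {x : X} (p q : Path x x) :
    loopClass (p.trans q) = loopClass q * loopClass p := rfl

theorem loopClass_concatPow {X : Type*} [TopologicalSpace X] {x : X} (p : Path x x) (n : ℕ) :
    loopClass (p.concatPow n) = loopClass p ^ n := by
  induction n with
  | zero => rfl
  | succ n ih => rw [Path.concatPow, loopClass_trans, ih, pow_succ]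

/-- Inversion takes the circles through 0 to the vertical lines with real part $n/2$. Thus
$2\,\mathrm{Re}(1/w)$ is a continuous function off 0 that reads off the index of the circle. -/
theorem mem_circle_iff {w : ℂ} (hw : w ≠ 0) (n : ℕ+) : w ∈ circle n ↔ 2 * (w⁻¹).re = n := by
  have hn : (0 : ℝ) < n := by exact_mod_cast n.pos
  have hN : 0 < Complex.normSq w := Complex.normSq_pos.2 hw
  have hc : (1 / (n : ℂ)) = ((1 / (n : ℝ) : ℝ) : ℂ) := by push_cast; rfl
  rw [circle, mem_sphere_iff_norm, ← sq_eq_sq₀ (norm_nonneg _) (by positivity),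
    ← Complex.normSq_eq_norm_sq, hc, Complex.normSq_apply, Complex.sub_re, Complex.sub_im,
    Complex.ofReal_re, Complex.ofReal_im, Complex.inv_re, ← mul_div_assoc, div_eq_iff hN.ne',
    Complex.normSq_apply]
  field_simp
  constructor <;> intro h <;> nlinarith

theorem isClosed_earringSet : IsClosed earringSet := by
  set S : Set ℝ := Set.range fun n : ℕ+ ↦ (n : ℝ)
  have hS : IsClosed S := by
    have h := (Nat.isClosedEmbedding_coe_real.isClosedMap) (Set.Ici 1) (isClosed_discrete _)
    convert h using 1
    ext x
    constructor
    · rintro ⟨n, rfl⟩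
      exact ⟨n, n.pos, rfl⟩
    · rintro ⟨n, hn, rfl⟩
      exact ⟨⟨n, hn⟩, rfl⟩
  have hf : ContinuousOn (fun w : ℂ ↦ 2 * (w⁻¹).re) {0}ᶜ := fun w hw ↦
    (continuousAt_const.mul (Complex.continuous_re.continuousAt.comp
      (continuousAt_inv₀ hw))).continuousWithinAt
  rw [← isOpen_compl_iff]
  convert hf.isOpen_inter_preimage isOpen_compl_singleton hS.isOpen_compl using 1
  ext w
  by_cases hw : w = 0
  · have h0 : (0 : ℂ) ∈ earringSet := earringBase.2
    simp [hw, h0]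
  · simp only [earringSet, Set.mem_compl_iff, Set.mem_iUnion, mem_circle_iff hw, Set.mem_inter_iff,
      Set.mem_singleton_iff, hw, not_false_eq_true, Set.mem_preimage, true_and, S, Set.mem_range,
      eq_comm]

instance : CompleteSpace Earring := isClosed_earringSet.completeSpace_coe

theorem dist_earringLoop_le (n : ℕ+) (t : I) :
    dist (earringLoop n t) earringBase ≤ 2 / (n : ℝ) := by
  change dist (loopPoint n t) 0 ≤ _
  have h := norm_sub_le (1 : ℂ) (Complex.exp (-(2 * Real.pi * (t : ℝ) * Complex.I)))
  rw [norm_exp_turn, norm_one] at h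
  have hn : ‖(1 / (n : ℂ))‖ = 1 / (n : ℝ) := by simp
  rw [dist_zero_right, loopPoint, norm_mul, hn, div_mul_eq_mul_div, one_mul]
  gcongr
  linarith

/-- Homomorphisms from the fundamental group of the Hawaiian Earring to a free group kill almost
all of the loops `ℓ_n`. -/
theorem exists_forall_earringLoop_eq_one_of_isFreeGroup {S : Type*} [Group S] [IsFreeGroup S]
    (h : FundamentalGroup Earring earringBase →* S) :
    ∃ k : ℕ+, ∀ n ≥ k, h (loopClass (earringLoop n)) = 1 := by
  classical
  let φ := (IsFreeGroup.toFreeGroup S).toMonoidHom.comp h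
  set g : ℕ → FreeGroup (IsFreeGroup.Generators S) :=
    fun k ↦ φ (loopClass (earringLoop k.succPNat))
  -- The exponents may depend on `h`, through the lengths of the images, since the loops are built
  -- afterwards.
  obtain ⟨x, hx⟩ := Path.exists_nested_concat (l := fun k ↦ earringLoop k.succPNat)
    (r := fun k ↦ 2 / ((k : ℝ) + 1)) (fun i j hij ↦ by dsimp only; gcongr)
    (tendsto_const_div_atTop_nhds_zero_nat 2 |>.comp (tendsto_add_atTop_nat 1) |>.congr
      fun k ↦ by simp)
    (fun k t ↦ (dist_earringLoop_le _ t).trans_eq (by simp))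
    (fun k ↦ k + ∑ i ∈ Finset.range (k + 1), (g i).norm + 1)
  obtain ⟨K, hK⟩ := FreeGroup.eventually_eq_one_of_pow_mul g (fun k ↦ φ (loopClass (x k)))
    (fun k ↦ by
      rw [← map_pow, ← map_mul, ← loopClass_concatPow, ← loopClass_trans, ← hx])
  refine ⟨K.succPNat, fun n hn ↦ ?_⟩
  have h1 := hK (n - 1) (Nat.le_sub_one_of_lt (Nat.lt_of_succ_le hn))
  have h2 : ((n : ℕ) - 1).succPNat = n := PNat.eq (Nat.sub_add_cancel n.pos)
  simpa [g, φ, h2] using h1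

end HawaiianPants

open CategoryTheory

/-! ### Loops killed by a homomorphism -/

namespace CategoryTheory

universe v₁ v₂ u₁ u₂

variable {C : Type u₁} [Groupoid.{v₁} C] {D : Type u₂} [Groupoid.{v₂} D] {S : Type*} [Group S]
  {b : C}

/-- The image of the loop `g` under the functor `F` is killed by `h`, along any path to the
base point of `h`. -/
def Killed (F : D ⥤ C) (h : End b →* S) {x : D} (g : End x) : Prop :=
  ∀ e : b ⟶ F.obj x, h (e ≫ F.map g ≫ inv e) = 1

variable {F : D ⥤ C} {h : End b →* S} {x y : D}

/-- Quantifying over all paths `e` makes the property stable under change of base point, so no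
connecting paths need to be tracked in the pants. -/
theorem Killed.conj {g : End x} (hg : Killed F h g) (η : y ⟶ x) :
    Killed F h (η ≫ g ≫ inv η : y ⟶ y) := fun e ↦ by
  simpa using hg (e ≫ F.map η)

theorem Killed.comp {g g' : x ⟶ x} (hg : Killed F h g) (hg' : Killed F h g') :
    Killed F h (g ≫ g' : x ⟶ x) := fun e ↦ by
  have key : e ≫ F.map (g ≫ g') ≫ inv e = (e ≫ F.map g ≫ inv e) ≫ (e ≫ F.map g' ≫ inv e) := by
    simp
  rw [key, ← End.mul_def, map_mul, hg e, hg' e, one_mul]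

theorem Killed.one : Killed F h (1 : End x) := fun e ↦ by
  have key : e ≫ F.map (1 : End x) ≫ inv e = 𝟙 b := by
    rw [End.one_def, F.map_id, Category.id_comp, IsIso.hom_inv_id]
  rw [key, ← End.one_def, map_one]

theorem Killed.inv {g : End x} (hg : Killed F h g) : Killed F h g⁻¹ := fun e ↦ by
  have h1 : F.map g ≫ F.map (g⁻¹ : End x) = 𝟙 _ := by
    rw [← F.map_comp, ← End.mul_def, inv_mul_cancel, End.one_def, F.map_id]
  have key : (e ≫ F.map g ≫ CategoryTheory.inv e) ≫
      (e ≫ F.map (g⁻¹ : End x) ≫ CategoryTheory.inv e) = 𝟙 b := by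
    simp [reassoc_of% h1]
  have h2 := congrArg h key
  rwa [← End.mul_def, ← End.one_def, map_mul, hg e, mul_one, map_one] at h2

theorem Killed.zpow {g : End x} (hg : Killed F h g) (n : ℤ) : Killed F h (g ^ n) := by
  have hpow (m : ℕ) : Killed F h (g ^ m) := by
    induction m with
    | zero => simpa using Killed.one
    | succ m ih =>
      rw [pow_succ', End.mul_def]
      exact ih.comp hg
  cases n with
  | ofNat m => simpa using hpow m
  | negSucc m =>
    rw [zpow_negSucc]
    exact (hpow _).inv

end CategoryTheory

/-! ### The fundamental group of the circle -/

namespace Circle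

/-- The loop which runs once around the circle. -/
noncomputable def stdLoop : Path (1 : Circle) 1 where
  toFun t := Circle.exp (2 * Real.pi * t)
  continuous_toFun := by fun_prop
  source' := by simp
  target' := by simp

/-- The base point of the universal cover. -/
def expBase : Circle.exp ⁻¹' {(1 : Circle)} := ⟨0, Circle.exp_zero⟩

/-- The endpoint of the lift of the standard loop. -/
noncomputable def expTurn : Circle.exp ⁻¹' {(1 : Circle)} := ⟨2 * Real.pi, Circle.exp_two_pi⟩

theorem monodromy_stdLoop :
    Circle.isCoveringMap_exp.monodromy (Path.Homotopic.Quotient.mk stdLoop) expBase = expTurn := by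
  let Γ : Path (0 : ℝ) (2 * Real.pi) :=
    { toFun := fun t ↦ 2 * Real.pi * t
      continuous_toFun := by fun_prop
      source' := by simp
      target' := by simp }
  exact Circle.isCoveringMap_exp.monodromy_eq_of_map_eq (ex := expBase) (ey := expTurn)
    (Path.Homotopic.Quotient.mk Γ) rfl

theorem stdLoop_not_homotopic_refl : ¬ stdLoop.Homotopic (Path.refl 1) := fun h ↦ by
  have h1 := monodromy_stdLoop
  rw [Path.Homotopic.Quotient.eq.2 h, Path.Homotopic.Quotient.mk_refl,
    IsCoveringMap.monodromy_refl] at h1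
  have h2 : (0 : ℝ) = 2 * Real.pi := congrArg Subtype.val h1
  have := Real.pi_pos
  linarith

/-- Monodromy on the universal cover $\mathbb{R}$ embeds the group into the deck group
$2\pi\mathbb{Z}$ (up to the opposite), and the standard loop goes to its generator. -/
theorem exists_eq_stdLoop_zpow (γ : FundamentalGroup Circle 1) :
    ∃ n : ℤ, γ = (FundamentalGroup.fromPath (Path.Homotopic.Quotient.mk stdLoop)) ^ n := by
  have hp := Circle.isAddQuotientCoveringMap_exp
  set ψ := hp.fundamentalGroupToMulOpposite expBase
  have hinj : Function.Injective ψ := hp.fundamentalGroupToMulOpposite_injective expBase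
  let τ : AddSubgroup.zmultiples (2 * Real.pi) := ⟨2 * Real.pi, AddSubgroup.mem_zmultiples _⟩
  have hstd : ψ (FundamentalGroup.fromPath (Path.Homotopic.Quotient.mk stdLoop)) =
      MulOpposite.op (Multiplicative.ofAdd τ) := by
    refine hp.fundamentalGroupToMulOpposite_apply_eq_Iff.2 ?_
    refine Eq.trans ?_ (congrArg Subtype.val monodromy_stdLoop).symm
    change 2 * Real.pi + 0 = 2 * Real.pi
    rw [add_zero]
  obtain ⟨n, hn⟩ := AddSubgroup.mem_zmultiples_iff.1 (ψ γ).unop.toAdd.2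
  refine ⟨n, hinj ?_⟩
  rw [map_zpow, hstd]
  apply MulOpposite.unop_injective
  apply Multiplicative.toAdd.injective
  apply Subtype.ext
  rw [← hn]
  simp [τ]

theorem exists_eq_conj_stdLoop_zpow {x : FundamentalGroupoid Circle} (g : End x) :
    ∃ (η : x ⟶ FundamentalGroupoid.mk 1) (n : ℤ), g = η ≫
      ((FundamentalGroup.fromPath (Path.Homotopic.Quotient.mk stdLoop)) ^ n :
        FundamentalGroup Circle 1) ≫ inv η := by
  let η : x ⟶ FundamentalGroupoid.mk 1 :=
    Path.Homotopic.Quotient.mk (PathConnectedSpace.somePath x.as 1)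
  obtain ⟨n, hn⟩ := exists_eq_stdLoop_zpow (inv η ≫ g ≫ η)
  refine ⟨η, n, ?_⟩
  rw [← hn]
  simp

end Circle

namespace HawaiianPants

/-! ### Half pants -/

/-- The center `2i` or `-2i` of an inner disk. -/
noncomputable def innerCenter (ε : ℝ) : ℂ := ⟨0, 2 * ε⟩

theorem innerCenter_im (ε : ℝ) : (innerCenter ε).im = 2 * ε := rfl

theorem innerCenter_one : innerCenter 1 = 2 * Complex.I := by
  apply Complex.ext <;> simp [innerCenter]

theorem innerCenter_neg_one : innerCenter (-1) = -2 * Complex.I := by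
  apply Complex.ext <;> simp [innerCenter]

theorem mem_pantsSet_iff {ε : ℝ} (hε : ε = 1 ∨ ε = -1) {z : ℂ} :
    z ∈ pantsSet ↔ ‖z‖ ≤ 4 ∧ 1 ≤ ‖z - innerCenter ε‖ ∧ 1 ≤ ‖z - innerCenter (-ε)‖ := by
  have h1 : z ∈ pantsSet ↔
      ‖z‖ ≤ 4 ∧ 1 ≤ ‖z - innerCenter 1‖ ∧ 1 ≤ ‖z - innerCenter (-1)‖ := by
    rw [innerCenter_one, innerCenter_neg_one, pantsSet]
    simp [dist_eq_norm]
  rcases hε with rfl | rfl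
  · exact h1
  · rw [h1, neg_neg, and_comm (a := 1 ≤ ‖z - innerCenter 1‖)]

/-- The closed half-plane has distance 2 from the center of the opposite inner disk. -/
theorem mem_pantsSet_of_im {ε : ℝ} (hε : ε = 1 ∨ ε = -1) {z : ℂ} (h4 : ‖z‖ ≤ 4)
    (h1 : 1 ≤ ‖z - innerCenter ε‖) (him : 0 ≤ ε * z.im) : z ∈ pantsSet := by
  refine (mem_pantsSet_iff hε).2 ⟨h4, h1, ?_⟩
  have h := abs_le.1 (Complex.abs_im_le_norm (z - innerCenter (-ε)))
  rw [Complex.sub_im, innerCenter_im] at h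
  rcases hε with rfl | rfl <;> linarith

theorem norm_innerCenter {ε : ℝ} (hε : ε = 1 ∨ ε = -1) : ‖innerCenter ε‖ = 2 := by
  rcases hε with rfl | rfl
  · rw [innerCenter_one]; simp
  · rw [innerCenter_neg_one]; simp

/-- The half of the pair of pants which contains the inner circle around `innerCenter ε`. -/
abbrev HalfPants (ε : ℝ) : Type := {z : Pants // 0 ≤ ε * (z : ℂ).im}

variable {ε : ℝ}

theorem one_le_norm_sub (hε : ε = 1 ∨ ε = -1) (z : Pants) : 1 ≤ ‖(z : ℂ) - innerCenter ε‖ :=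
  ((mem_pantsSet_iff hε).1 z.2).2.1

theorem unit_mem_pantsSet (hε : ε = 1 ∨ ε = -1) {u : ℂ} (hu : ‖u‖ = 1) :
    innerCenter ε + u ∈ pantsSet := by
  refine mem_pantsSet_of_im hε ?_ ?_ ?_
  · have := norm_add_le (innerCenter ε) u
    rw [norm_innerCenter hε, hu] at this
    linarith
  · rw [add_sub_cancel_left, hu]
  · have := (abs_le.1 (Complex.abs_im_le_norm u))
    rw [hu] at this
    rw [Complex.add_im, innerCenter_im]
    rcases hε with rfl | rfl <;> linarith

/-- The parametrization of an inner boundary circle. -/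
noncomputable def innerCircle (hε : ε = 1 ∨ ε = -1) : C(Circle, Pants) where
  toFun u := ⟨innerCenter ε + (-(u⁻¹ : Circle) : ℂ), unit_mem_pantsSet hε (by
    rw [norm_neg, Circle.norm_coe])⟩
  continuous_toFun := by fun_prop

/-- The normalization of a nonzero complex number. -/
noncomputable def normalize : C({z : ℂ // z ≠ 0}, Circle) where
  toFun z := ⟨z / ‖(z : ℂ)‖, mem_sphere_zero_iff_norm.2 (by simp [z.2])⟩
  continuous_toFun := by
    refine Continuous.subtype_mk (Continuous.div (by fun_prop) (by fun_prop) fun z ↦ ?_) _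
    simpa using z.2

theorem coe_normalize (z : {z : ℂ // z ≠ 0}) : (normalize z : ℂ) = z / ‖(z : ℂ)‖ := rfl

theorem innerCenter_sub_ne_zero (hε : ε = 1 ∨ ε = -1) (z : Pants) :
    innerCenter ε - (z : ℂ) ≠ 0 := fun h ↦ by
  have := one_le_norm_sub hε z
  rw [← neg_sub, h] at this
  norm_num at this

/-- The radial projection of half of the pair of pants to the inner boundary circle. -/
noncomputable def radialProj (hε : ε = 1 ∨ ε = -1) : C(HalfPants ε, Circle) where
  toFun z := (normalize ⟨innerCenter ε - (z : Pants), innerCenter_sub_ne_zero hε z⟩)⁻¹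
  continuous_toFun := by fun_prop

/-- The inclusion of half of the pair of pants. -/
def halfPantsIncl (ε : ℝ) : C(HalfPants ε, Pants) := ⟨Subtype.val, continuous_subtype_val⟩

/-- The half disk is convex and contains the center of its inner disk, so moving radially towards
that center can only fail by entering the inner disk. -/
theorem scaled_mem_pantsSet (hε : ε = 1 ∨ ε = -1) (z : HalfPants ε) {s : ℝ} (hs0 : 0 ≤ s)
    (hs1 : s ≤ 1) (hs : 1 ≤ s * ‖((z : Pants) : ℂ) - innerCenter ε‖) :
    innerCenter ε + s * (((z : Pants) : ℂ) - innerCenter ε) ∈ pantsSet := by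
  have hz := ((mem_pantsSet_iff hε).1 z.1.2).1
  have him := z.2
  refine mem_pantsSet_of_im hε ?_ ?_ ?_
  · have h1 : innerCenter ε + s * (((z : Pants) : ℂ) - innerCenter ε) =
        ((1 - s : ℝ) : ℂ) * innerCenter ε + (s : ℂ) * (z : Pants) := by
      push_cast
      ring
    rw [h1]
    refine (norm_add_le _ _).trans ?_
    rw [norm_mul, norm_mul, Complex.norm_of_nonneg (sub_nonneg.2 hs1), Complex.norm_of_nonneg hs0,
      norm_innerCenter hε]
    nlinarith
  · rwa [add_sub_cancel_left, norm_mul, Complex.norm_of_nonneg hs0]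
  · rw [Complex.add_im, Complex.im_ofReal_mul, Complex.sub_im, innerCenter_im]
    rcases hε with rfl | rfl <;> nlinarith

/-- The factor by which the radial homotopy moves a point towards the center. -/
noncomputable def radialFactor (ε : ℝ) (p : I × HalfPants ε) : ℝ :=
  1 - p.1 + p.1 / ‖((p.2 : Pants) : ℂ) - innerCenter ε‖

theorem radialFactor_mem (hε : ε = 1 ∨ ε = -1) (p : I × HalfPants ε) :
    0 ≤ radialFactor ε p ∧ radialFactor ε p ≤ 1 ∧
      1 ≤ radialFactor ε p * ‖((p.2 : Pants) : ℂ) - innerCenter ε‖ := by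
  have hr := one_le_norm_sub hε p.2
  set r := ‖((p.2 : Pants) : ℂ) - innerCenter ε‖
  have h0 := p.1.2.1
  have h1 := p.1.2.2
  have hd : (p.1 : ℝ) / r ≤ p.1 := div_le_self h0 hr
  have hd0 : 0 ≤ (p.1 : ℝ) / r := by positivity
  have hm : (p.1 : ℝ) / r * r = p.1 := div_mul_cancel₀ _ (by positivity)
  refine ⟨?_, ?_, ?_⟩ <;> rw [radialFactor]
  · linarith
  · linarith
  · nlinarith

/-- The radial homotopy from half of the pair of pants to the inner boundary circle. -/
noncomputable def radialHomotopy (hε : ε = 1 ∨ ε = -1) :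
    (halfPantsIncl ε).Homotopy ((innerCircle hε).comp (radialProj hε)) where
  toFun p := ⟨innerCenter ε + radialFactor ε p * (((p.2 : Pants) : ℂ) - innerCenter ε),
    scaled_mem_pantsSet hε p.2 (radialFactor_mem hε p).1 (radialFactor_mem hε p).2.1
      (radialFactor_mem hε p).2.2⟩
  continuous_toFun := by
    refine Continuous.subtype_mk ?_ _
    have : Continuous (radialFactor ε) := by
      unfold radialFactor
      refine (by fun_prop : Continuous fun p : I × HalfPants ε ↦ 1 - (p.1 : ℝ)).add
        (Continuous.div (by fun_prop) (by fun_prop) fun p ↦ ?_)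
      have := one_le_norm_sub hε p.2
      positivity
    fun_prop
  map_zero_left z := by
    apply Subtype.ext
    simp [radialFactor, halfPantsIncl]
  map_one_left z := by
    apply Subtype.ext
    simp only [radialFactor, innerCircle, radialProj, ContinuousMap.comp_apply,
      ContinuousMap.coe_mk, inv_inv, coe_normalize, Set.Icc.coe_one, sub_self, zero_add,
      norm_sub_rev (innerCenter ε)]
    push_cast
    ring

/-! ### Loops in a pair of pants -/

variable {X : Type*} [TopologicalSpace X] {b : X} {S : Type*} [Group S]

/-- The radial homotopy makes a loop in one half a conjugate of a loop on the inner circle, and the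
latter is a conjugate of a power of the standard one. -/
theorem killed_of_im_nonneg (hε : ε = 1 ∨ ε = -1) (j : C(Pants, X))
    (h : FundamentalGroup X b →* S)
    (hj : Killed (FundamentalGroupoid.map (j.comp (innerCircle hε))) h
      (FundamentalGroup.fromPath (Path.Homotopic.Quotient.mk Circle.stdLoop)))
    {x : Pants} (w : Path x x) (hw : ∀ t, 0 ≤ ε * (w t : ℂ).im) :
    Killed (FundamentalGroupoid.map j) h
      (FundamentalGroup.fromPath (Path.Homotopic.Quotient.mk w)) := by
  let x' : HalfPants ε := ⟨x, by simpa using hw 0⟩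
  let w' : Path x' x' :=
    { toFun := fun t ↦ ⟨w t, hw t⟩
      continuous_toFun := by fun_prop
      source' := Subtype.ext w.source
      target' := Subtype.ext w.target }
  let g : FundamentalGroupoid.mk x' ⟶ FundamentalGroupoid.mk x' := Path.Homotopic.Quotient.mk w'
  let τ := FundamentalGroupoidFunctor.homotopicMapsNatIso (radialHomotopy hε)
  have hnat := τ.naturality g
  obtain ⟨η, n, hη⟩ := Circle.exists_eq_conj_stdLoop_zpow
    ((FundamentalGroupoid.map (radialProj hε)).map g)
  have hg : Killed (FundamentalGroupoid.map (j.comp (innerCircle hε))) h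
      ((FundamentalGroupoid.map (radialProj hε)).map g) := by
    rw [hη]
    exact (hj.zpow n).conj η
  have key : (FundamentalGroupoid.map (halfPantsIncl ε)).map g = τ.app _ ≫
      (FundamentalGroupoid.map ((innerCircle hε).comp (radialProj hε))).map g ≫
      inv (τ.app _) := by
    rw [← reassoc_of% hnat, IsIso.hom_inv_id, Category.comp_id]
  change Killed _ h ((FundamentalGroupoid.map (halfPantsIncl ε)).map g)
  rw [key]
  refine Killed.conj ?_ _
  exact fun e ↦ hg e

/-- The loop `q` is given separately because `j y` and `b` need not be definitionally equal. One
path suffices for all `e` because the kernel of `h` is normal. -/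
theorem killed_mk_iff {Y : Type*} [TopologicalSpace Y] (j : C(Y, X)) (h : FundamentalGroup X b →* S)
    {y : Y} (p : Path y y) (q : Path b b) (hpq : ∀ t, j (p t) = q t) :
    Killed (FundamentalGroupoid.map j) h
      (FundamentalGroup.fromPath (Path.Homotopic.Quotient.mk p)) ↔ h (loopClass q) = 1 := by
  have hy : j y = b := by simpa using hpq 0
  subst hy
  obtain rfl : q = p.map j.continuous := Path.ext (funext fun t ↦ (hpq t).symm)
  constructor
  · intro hp
    let x : FundamentalGroupoid X := FundamentalGroupoid.mk (j y)
    have key (g : x ⟶ x) : 𝟙 x ≫ g ≫ inv (𝟙 x) = g := by simp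
    exact (congrArg h (key _)).symm.trans (hp (𝟙 x))
  · intro hq e
    let e' : FundamentalGroup X (j y) := e
    change h (e' ≫ loopClass (p.map j.continuous) ≫ inv e') = 1
    have h2 : (e' ≫ inv e') = 𝟙 _ := IsIso.hom_inv_id _
    have h3 := congrArg h h2
    rw [← End.mul_def, ← End.one_def, map_mul, map_one] at h3
    rw [← End.mul_def, ← End.mul_def, map_mul, map_mul, hq, mul_one, h3]

theorem clockwise_zero_four_mem (t : ℝ) : clockwise 0 4 t ∈ pantsSet := by
  have h : ‖clockwise 0 4 t‖ = 4 := by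
    have := clockwise_mem 0 (r := 4) (by norm_num) t
    simpa using this
  refine (mem_pantsSet_iff (Or.inl rfl)).2 ⟨h.le, ?_, ?_⟩
  · have := norm_sub_norm_le (clockwise 0 4 t) (innerCenter 1)
    rw [h, norm_innerCenter (Or.inl rfl)] at this
    linarith
  · have := norm_sub_norm_le (clockwise 0 4 t) (innerCenter (-1))
    rw [h, norm_innerCenter (Or.inr rfl)] at this
    linarith

theorem clockwise_zero_four_im (t : ℝ) :
    (clockwise 0 4 t).im = 4 * Real.sin (2 * Real.pi * t) := by
  have h : ((4 : ℝ) : ℂ) = (4 : ℝ) := rfl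
  rw [clockwise, Complex.sub_im, Complex.im_ofReal_mul]
  simp [Complex.exp_im]

theorem ofReal_mem_pantsSet {x : ℝ} (hx : |x| ≤ 4) : (x : ℂ) ∈ pantsSet := by
  refine mem_pantsSet_of_im (Or.inl rfl) (by simpa using hx) ?_ (by simp)
  refine le_trans ?_ (Complex.abs_im_le_norm _)
  simp [innerCenter]

/-- The outer boundary circle of a pair of pants, as an arc. -/
noncomputable def outerPoint (t : ℝ) : Pants := ⟨clockwise 0 4 t, clockwise_zero_four_mem t⟩

theorem continuous_outerPoint : Continuous outerPoint := by
  refine Continuous.subtype_mk ?_ _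
  unfold clockwise
  fun_prop

theorem clockwise_half : clockwise 0 4 (1 / 2) = 4 := by
  have : -(2 * (Real.pi : ℂ) * ((1 / 2 : ℝ) : ℂ) * Complex.I) = -(Real.pi * Complex.I) := by
    push_cast
    ring
  rw [clockwise, this, Complex.exp_neg, Complex.exp_pi_mul_I]
  norm_num

theorem clockwise_one : clockwise 0 4 1 = clockwise 0 4 0 := by
  rw [clockwise, clockwise, exp_turn_one]
  simp

/-- The outer boundary loop of a pair of pants. -/
noncomputable def outerLoop : Path (outerPoint 0) (outerPoint 0) where
  toFun t := outerPoint t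
  continuous_toFun := continuous_outerPoint.comp continuous_subtype_val
  source' := rfl
  target' := Subtype.ext (by
    change clockwise 0 4 ((1 : I) : ℝ) = clockwise 0 4 0
    rw [Set.Icc.coe_one, clockwise_one])

/-- The upper half of the outer boundary loop. -/
noncomputable def outerUpper : Path (outerPoint 0) (outerPoint (1 / 2)) where
  toFun t := outerPoint (t / 2)
  continuous_toFun := continuous_outerPoint.comp (by fun_prop)
  source' := by simp
  target' := by simp

/-- The lower half of the outer boundary loop. -/
noncomputable def outerLower : Path (outerPoint (1 / 2)) (outerPoint 0) where
  toFun t := outerPoint ((t + 1) / 2)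
  continuous_toFun := continuous_outerPoint.comp (by fun_prop)
  source' := by simp
  target' := Subtype.ext (by
    change clockwise 0 4 (((1 : I) + 1 : ℝ) / 2) = clockwise 0 4 0
    rw [Set.Icc.coe_one, add_self_div_two, clockwise_one])

/-- The straight path which separates the inner disks. -/
noncomputable def waist : Path (outerPoint (1 / 2)) (outerPoint 0) where
  toFun t := ⟨((4 - 8 * t : ℝ) : ℂ), ofReal_mem_pantsSet (by
    rw [abs_le]
    constructor <;> linarith [t.2.1, t.2.2])⟩
  continuous_toFun := by fun_prop
  source' := Subtype.ext (by
    change _ = clockwise 0 4 (1 / 2)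
    rw [clockwise_half]
    simp)
  target' := Subtype.ext (by
    change _ = clockwise 0 4 0
    simp [clockwise]
    norm_num)

theorem outerUpper_trans_outerLower : outerUpper.trans outerLower = outerLoop := by
  ext t
  rw [Path.trans_apply]
  split_ifs
  · change clockwise 0 4 (2 * (t : ℝ) / 2) = clockwise 0 4 t
    congr 1
    ring
  · change clockwise 0 4 ((2 * (t : ℝ) - 1 + 1) / 2) = clockwise 0 4 t
    congr 1
    ring

/-- Cut along the waist: upper arc · lower arc = (upper arc · waist) · (waist⁻¹ · lower arc), and
each factor lies in one half. This takes the place of van Kampen's theorem. -/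
theorem killed_outerLoop (j : C(Pants, X)) (h : FundamentalGroup X b →* S)
    (hj : ∀ (ε : ℝ) (hε : ε = 1 ∨ ε = -1),
      Killed (FundamentalGroupoid.map (j.comp (innerCircle hε))) h
        (FundamentalGroup.fromPath (Path.Homotopic.Quotient.mk Circle.stdLoop))) :
    Killed (FundamentalGroupoid.map j) h
      (FundamentalGroup.fromPath (Path.Homotopic.Quotient.mk outerLoop)) := by
  have h1 := killed_of_im_nonneg (Or.inl rfl) j h (hj 1 _) (outerUpper.trans waist) (fun t ↦ by
    rw [Path.trans_apply]
    split_ifs with ht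
    · change 0 ≤ 1 * (clockwise 0 4 (2 * (t : ℝ) / 2)).im
      rw [clockwise_zero_four_im, one_mul]
      refine mul_nonneg (by norm_num) (Real.sin_nonneg_of_nonneg_of_le_pi ?_ ?_)
      · have := t.2.1
        positivity
      · nlinarith [Real.pi_pos]
    · simp [waist])
  have h2 := killed_of_im_nonneg (Or.inr rfl) j h (hj (-1) _) (waist.symm.trans outerLower)
    (fun t ↦ by
      rw [Path.trans_apply]
      split_ifs with ht
      · simp [waist, Path.symm]
      · change 0 ≤ -1 * (clockwise 0 4 ((2 * (t : ℝ) - 1 + 1) / 2)).im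
        have hs := Real.sin_nonneg_of_nonneg_of_le_pi (x := 2 * Real.pi * t - Real.pi)
          (by nlinarith [Real.pi_pos]) (by nlinarith [Real.pi_pos, t.2.2])
        rw [Real.sin_sub_pi] at hs
        rw [clockwise_zero_four_im, sub_add_cancel, mul_div_cancel_left₀ _ two_ne_zero]
        linarith)
  have h3 := h1.comp h2
  let u : FundamentalGroupoid.mk (outerPoint 0) ⟶ FundamentalGroupoid.mk (outerPoint (1 / 2)) :=
    Path.Homotopic.Quotient.mk outerUpper
  let l : FundamentalGroupoid.mk (outerPoint (1 / 2)) ⟶ FundamentalGroupoid.mk (outerPoint 0) :=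
    Path.Homotopic.Quotient.mk outerLower
  let w : FundamentalGroupoid.mk (outerPoint (1 / 2)) ⟶ FundamentalGroupoid.mk (outerPoint 0) :=
    Path.Homotopic.Quotient.mk waist
  rw [← outerUpper_trans_outerLower]
  have key : u ≫ l = (u ≫ w) ≫ (inv w ≫ l) := by simp
  change Killed _ h (u ≫ l)
  rw [key, ← Groupoid.inv_eq_inv]
  exact h3

/-! ### The relation given by a pair of pants -/

/-- The canonical map `P_n → ℙ`. -/
def pantsMap (n : ℕ+) : C(Pants, HPants) where
  toFun z := Quot.mk _ (Sum.inr ⟨n, z⟩)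
  continuous_toFun := continuous_quot_mk.comp (continuous_inr.comp continuous_sigmaMk)

theorem pantsMap_boundary (n : ℕ+) (z : Pants) (hz : z ∈ pantsBoundary) {y : Earring}
    (hy : attachPoint n (z : ℂ) = y) : pantsMap n z = incl y := by
  obtain rfl : coprodAttach ⟨⟨n, z⟩, hz⟩ = y := Subtype.ext hy
  exact Quot.sound ⟨⟨⟨n, z⟩, hz⟩, rfl, rfl⟩

theorem pantsMap_outerLoop (n : ℕ+) (t : I) : pantsMap n (outerLoop t) = pantsLoop n t :=
  pantsMap_boundary n (outerLoop t) (Or.inl (Or.inl (clockwise_mem 0 (by norm_num) t)))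
    (attachPoint_outer n t)

/-- The inverse and the sign in `innerCircle` turn the counterclockwise loop from 1 into the
clockwise loop from the leftmost point. -/
theorem coe_innerCircle_stdLoop (hε : ε = 1 ∨ ε = -1) (t : I) :
    (innerCircle hε (Circle.stdLoop t) : ℂ) = clockwise (innerCenter ε) 1 t := by
  change innerCenter ε + -((Circle.exp (2 * Real.pi * t))⁻¹ : Circle) = _
  rw [← Circle.exp_neg, Circle.coe_exp, clockwise]
  push_cast
  rw [one_mul, neg_mul, ← sub_eq_add_neg]

theorem pantsMap_innerCircle_one (n : ℕ+) (t : I) :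
    (pantsMap n).comp (innerCircle (Or.inl rfl)) (Circle.stdLoop t) = pantsLoop (2 * n) t := by
  have h := coe_innerCircle_stdLoop (ε := 1) (Or.inl rfl) t
  rw [innerCenter_one] at h
  refine pantsMap_boundary n _ (Or.inl (Or.inr ?_)) ?_
  · rw [h]
    exact clockwise_mem _ (by norm_num) t
  · rw [h]
    exact attachPoint_inner_one n t

theorem pantsMap_innerCircle_two (n : ℕ+) (t : I) :
    (pantsMap n).comp (innerCircle (Or.inr rfl)) (Circle.stdLoop t) = pantsLoop (2 * n + 1) t := by
  have h := coe_innerCircle_stdLoop (ε := -1) (Or.inr rfl) t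
  rw [innerCenter_neg_one] at h
  refine pantsMap_boundary n _ (Or.inr ?_) ?_
  · rw [h]
    exact clockwise_mem _ (by norm_num) t
  · rw [h]
    exact attachPoint_inner_two n t

theorem map_pantsLoop_eq_one (h : FundamentalGroup HPants base →* S) {n : ℕ+}
    (h1 : h (loopClass (pantsLoop (2 * n))) = 1) (h2 : h (loopClass (pantsLoop (2 * n + 1))) = 1) :
    h (loopClass (pantsLoop n)) = 1 := by
  refine (killed_mk_iff (pantsMap n) h outerLoop _ (pantsMap_outerLoop n)).1
    (killed_outerLoop _ h ?_)
  rintro ε (rfl | rfl)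
  · exact (killed_mk_iff _ h _ _ (pantsMap_innerCircle_one n)).2 h1
  · exact (killed_mk_iff _ h _ _ (pantsMap_innerCircle_two n)).2 h2

/-- A homomorphism which kills almost all of the loops `ℓ_n` kills all of them. -/
theorem map_pantsLoop_eq_one_of_forall_ge (h : FundamentalGroup HPants base →* S) (k : ℕ+)
    (hk : ∀ n ≥ k, h (loopClass (pantsLoop n)) = 1) (n : ℕ+) :
    h (loopClass (pantsLoop n)) = 1 := by
  -- Both $2n$ and $2n+1$ exceed $n$ by at least one, so the deficit `d` decreases.
  obtain ⟨d, hd⟩ : ∃ d : ℕ, (k : ℕ) ≤ n + d := ⟨k, Nat.le_add_left _ _⟩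
  induction d generalizing n with
  | zero => exact hk n hd
  | succ d ih =>
    have hn := n.pos
    refine map_pantsLoop_eq_one h (ih _ ?_) (ih _ ?_)
    · rw [PNat.mul_coe, PNat.val_ofNat]
      omega
    · rw [PNat.add_coe, PNat.mul_coe, PNat.val_ofNat, PNat.one_coe]
      omega

theorem map_pantsLoop_eq_one_of_isNSlender (hS : IsNSlender S)
    (h : FundamentalGroup HPants base →* S) (n : ℕ+) : h (loopClass (pantsLoop n)) = 1 := by
  obtain ⟨k, hk⟩ := hS (h.comp (FundamentalGroup.map incl earringBase))
  exact map_pantsLoop_eq_one_of_forall_ge h k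
    (fun m hm ↦ hk (earringLoop m) fun t ↦ ⟨m, hm, loopPoint_mem_circle m t⟩) n

theorem map_pantsLoop_eq_one_of_isFreeGroup [IsFreeGroup S]
    (h : FundamentalGroup HPants base →* S) (n : ℕ+) : h (loopClass (pantsLoop n)) = 1 := by
  obtain ⟨k, hk⟩ := exists_forall_earringLoop_eq_one_of_isFreeGroup
    (h.comp (FundamentalGroup.map incl earringBase))
  exact map_pantsLoop_eq_one_of_forall_ge h k hk n

/-! ### Maps from the Hawaiian Earring to the plane -/

/-- A bounded continuous function which is `2 ^ j` at `2 ^ j` for `j ≤ J` and vanishes at all other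
natural numbers. -/
noncomputable def dyadicBump (J : ℕ) (x : ℝ) : ℝ :=
  ∑ j ∈ Finset.range (J + 1), 2 ^ j * max 0 (1 - |x - 2 ^ j|)

theorem continuous_dyadicBump (J : ℕ) : Continuous (dyadicBump J) := by
  unfold dyadicBump
  fun_prop

theorem max_zero_one_sub_abs_natCast {m n : ℕ} :
    max 0 (1 - |(m : ℝ) - n|) = if m = n then 1 else 0 := by
  split_ifs with h
  · simp [h]
  · apply max_eq_left
    have h1 : (1 : ℤ) ≤ |(m : ℤ) - n| := Int.one_le_abs (by omega)
    have h2 : (1 : ℝ) ≤ |(m : ℝ) - n| := by exact_mod_cast h1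
    linarith

theorem dyadicBump_natCast (J m : ℕ) :
    dyadicBump J m = ∑ j ∈ Finset.range (J + 1), if m = 2 ^ j then (m : ℝ) else 0 := by
  refine Finset.sum_congr rfl fun j _ ↦ ?_
  have h := max_zero_one_sub_abs_natCast (m := m) (n := 2 ^ j)
  push_cast at h
  rw [h]
  split_ifs with h1
  · simp [h1]
  · simp

theorem dyadicBump_pow {J j : ℕ} (hj : j ≤ J) : dyadicBump J ((2 ^ j : ℕ) : ℝ) = (2 ^ j : ℕ) := by
  rw [dyadicBump_natCast, Finset.sum_eq_single j]
  · simp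
  · intro i _ hij
    rw [if_neg fun h ↦ hij (Nat.pow_right_injective le_rfl h).symm]
  · intro h
    exact absurd (Finset.mem_range.2 (Nat.lt_succ_of_le hj)) h

theorem dyadicBump_eq_zero {J m : ℕ} (hm : ∀ j ≤ J, m ≠ 2 ^ j) : dyadicBump J m = 0 := by
  rw [dyadicBump_natCast]
  exact Finset.sum_eq_zero fun j hj ↦ if_neg (hm j (Nat.lt_succ_iff.1 (Finset.mem_range.1 hj)))

theorem dyadicBump_eq_or (J m : ℕ) : dyadicBump J m = m ∨ dyadicBump J m = 0 := by
  by_cases h : ∃ j ≤ J, m = 2 ^ j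
  · obtain ⟨j, hj, rfl⟩ := h
    exact Or.inl (dyadicBump_pow hj)
  · push Not at h
    exact Or.inr (dyadicBump_eq_zero h)

theorem abs_dyadicBump_le (J : ℕ) (x : ℝ) :
    |dyadicBump J x| ≤ ∑ j ∈ Finset.range (J + 1), 2 ^ j := by
  refine (Finset.abs_sum_le_sum_abs _ _).trans (Finset.sum_le_sum fun j _ ↦ ?_)
  rw [abs_mul, abs_of_nonneg (by positivity : (0 : ℝ) ≤ 2 ^ j), abs_of_nonneg (le_max_left _ _)]
  refine mul_le_of_le_one_right (by positivity) (max_le zero_le_one ?_)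
  linarith [abs_nonneg (x - 2 ^ j)]

/-- A map which winds the circles `C_m` with `m = 2 ^ j`, `j ≤ J`, around the unit circle, and
which is constant on all other circles `C_m`. -/
noncomputable def windEarring (J : ℕ) (w : ℂ) : ℂ := -1 + dyadicBump J (2 * (w⁻¹).re) * w

theorem continuous_windEarring (J : ℕ) : Continuous (windEarring J) := by
  refine continuous_const.add (continuous_iff_continuousAt.2 fun w ↦ ?_)
  by_cases hw : w = 0
  · subst hw
    rw [ContinuousAt, mul_zero]
    refine squeeze_zero_norm (a := fun w : ℂ ↦ (∑ j ∈ Finset.range (J + 1), 2 ^ j) * ‖w‖)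
      (fun w ↦ ?_) ?_
    · rw [norm_mul, Complex.norm_real, Real.norm_eq_abs]
      gcongr
      exact abs_dyadicBump_le J _
    · have : Continuous fun w : ℂ ↦ (∑ j ∈ Finset.range (J + 1), (2 : ℝ) ^ j) * ‖w‖ := by fun_prop
      simpa using this.tendsto 0
  · refine ContinuousAt.mul ?_ continuousAt_id
    exact Complex.continuous_ofReal.continuousAt.comp
      ((continuous_dyadicBump J).continuousAt.comp (continuousAt_const.mul
        (Complex.continuous_re.continuousAt.comp (continuousAt_inv₀ hw))))

theorem windEarring_of_mem_circle (J : ℕ) {m : ℕ+} {w : ℂ} (hw : w ∈ circle m) :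
    windEarring J w = -1 + dyadicBump J m * w := by
  by_cases h0 : w = 0
  · simp [windEarring, h0]
  · rw [windEarring, (mem_circle_iff h0 m).1 hw]

theorem windEarring_toCircle (J : ℕ) {c : ℂ} {r : ℝ} (hr : 0 < r) (m : ℕ+) {z : ℂ}
    (hz : z ∈ Metric.sphere c r) :
    windEarring J (toCircle c r m z) = -1 + dyadicBump J m * (1 / (m : ℂ) * (1 + (z - c) / r)) := by
  rw [windEarring_of_mem_circle J (toCircle_mem hr m hz), toCircle]

/-- On $C_m$ with $m=2^j$ the map is $w\mapsto mw-1$, the similarity onto the unit circle, which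
undoes `toCircle` up to normalization. -/
theorem windEarring_toCircle_pow {J j : ℕ} (hj : j ≤ J) {c : ℂ} {r : ℝ} (hr : 0 < r) {m : ℕ+}
    (hm : (m : ℕ) = 2 ^ j) {z : ℂ} (hz : z ∈ Metric.sphere c r) :
    windEarring J (toCircle c r m z) = (z - c) / r := by
  have hb : dyadicBump J m = (m : ℕ) := by rw [hm, dyadicBump_pow hj]
  have hm0 : ((m : ℕ) : ℂ) ≠ 0 := by exact_mod_cast m.ne_zero
  rw [windEarring_toCircle J hr m hz, hb, Complex.ofReal_natCast, ← mul_assoc,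
    mul_one_div_cancel hm0]
  ring

theorem windEarring_toCircle_of_ne {J : ℕ} {c : ℂ} {r : ℝ} (hr : 0 < r) {m : ℕ+}
    (hm : ∀ j ≤ J, (m : ℕ) ≠ 2 ^ j) {z : ℂ} (hz : z ∈ Metric.sphere c r) :
    windEarring J (toCircle c r m z) = -1 := by
  rw [windEarring_toCircle J hr m hz, dyadicBump_eq_zero hm]
  simp

theorem windEarring_ne_zero (J : ℕ) {w : ℂ} (hw : w ∈ earringSet) : windEarring J w ≠ 0 := by
  obtain ⟨m, hm⟩ := Set.mem_iUnion.1 hw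
  rw [windEarring_of_mem_circle J hm]
  rcases dyadicBump_eq_or J m with h | h
  · intro h0
    have hm0 : ((m : ℕ) : ℂ) ≠ 0 := by exact_mod_cast m.ne_zero
    rw [h, Complex.ofReal_natCast] at h0
    have hw1 : w = 1 / (m : ℂ) := by
      rw [eq_div_iff hm0]
      linear_combination h0
    rw [circle, hw1, mem_sphere_iff_norm, sub_self, norm_zero] at hm
    have : (0 : ℝ) < 1 / (m : ℝ) := one_div_pos.2 (by exact_mod_cast m.pos)
    linarith
  · rw [h]
    simp

/-! ### A map from a pair of pants to the punctured plane -/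

/-- A cutoff function which is `1` on the outer circle and `0` on the inner circles. -/
noncomputable def outerCutoff (z : ℂ) : ℝ := max 0 (‖z‖ - 3)

/-- A cutoff function which is `1` on the lower inner circle and `0` on the other circles. -/
noncomputable def innerCutoff (z : ℂ) : ℝ := max 0 (2 - ‖z - -2 * Complex.I‖)

/-- A map which winds the outer circle and the upper inner circle of a pair of pants once around
the origin, and which is constant on the lower inner circle. -/
noncomputable def windPants (z : ℂ) : ℂ :=
  outerCutoff z * (z / 4) - innerCutoff z +
    (1 - outerCutoff z - innerCutoff z) * (z - 2 * Complex.I)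

theorem continuous_windPants : Continuous windPants := by
  unfold windPants outerCutoff innerCutoff
  fun_prop

theorem norm_two_mul_I : ‖2 * Complex.I‖ = 2 := by simp

theorem norm_neg_two_mul_I : ‖-2 * Complex.I‖ = 2 := by simp

theorem two_mul_I_im : (2 * Complex.I).im = 2 := by simp

theorem neg_two_mul_I_im : (-2 * Complex.I).im = -2 := by simp

theorem windPants_of_outer {z : ℂ} (hz : z ∈ Metric.sphere (0 : ℂ) 4) : windPants z = z / 4 := by
  rw [mem_sphere_zero_iff_norm] at hz
  have h := norm_sub_norm_le z (-2 * Complex.I)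
  rw [norm_neg_two_mul_I, hz] at h
  have h1 : outerCutoff z = 1 := by
    rw [outerCutoff, hz]
    norm_num
  have h2 : innerCutoff z = 0 := max_eq_left (by linarith)
  rw [windPants, h1, h2]
  simp

theorem windPants_of_inner_one {z : ℂ} (hz : z ∈ Metric.sphere (2 * Complex.I) 1) :
    windPants z = z - 2 * Complex.I := by
  rw [mem_sphere_iff_norm] at hz
  have h := norm_sub_norm_le z (2 * Complex.I)
  have h' := norm_sub_le (z - -2 * Complex.I) (z - 2 * Complex.I)
  have h4 : z - -2 * Complex.I - (z - 2 * Complex.I) = 2 * (2 * Complex.I) := by ring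
  rw [h4, norm_mul, norm_two_mul_I, hz, Complex.norm_ofNat] at h'
  rw [norm_two_mul_I, hz] at h
  have h1 : outerCutoff z = 0 := max_eq_left (by linarith)
  have h2 : innerCutoff z = 0 := max_eq_left (by linarith)
  rw [windPants, h1, h2]
  simp

theorem windPants_of_inner_two {z : ℂ} (hz : z ∈ Metric.sphere (-2 * Complex.I) 1) :
    windPants z = -1 := by
  rw [mem_sphere_iff_norm] at hz
  have h := norm_sub_norm_le z (-2 * Complex.I)
  rw [norm_neg_two_mul_I, hz] at h
  have h1 : outerCutoff z = 0 := max_eq_left (by linarith)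
  have h2 : innerCutoff z = 1 := by
    rw [innerCutoff, hz]
    norm_num
  rw [windPants, h1, h2]
  simp

theorem windPants_ne_zero (z : Pants) : windPants z ≠ 0 := by
  obtain ⟨z, hz⟩ := z
  obtain ⟨h4, hp, hm⟩ := (mem_pantsSet_iff (Or.inl rfl)).1 hz
  rw [innerCenter_one] at hp
  rw [innerCenter_neg_one] at hm
  intro h0
  change windPants z = 0 at h0
  set s := outerCutoff z with hs
  set t := innerCutoff z with ht
  have hs0 : 0 ≤ s := le_max_left _ _
  have ht0 : 0 ≤ t := le_max_left _ _
  have hs1 : s ≤ 1 := max_le zero_le_one (by linarith)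
  have ht1 : t ≤ 1 := max_le zero_le_one (by linarith)
  -- Either the term for the lower inner circle is absent and norms are compared, or `z` is in the
  -- lower half-plane and imaginary parts decide.
  rcases ht0.eq_or_lt with ht2 | ht2
  · rw [windPants, ← hs, ← ht, ← ht2] at h0
    have h1 : ((1 - 3 / 4 * s : ℝ) : ℂ) * z = ((1 - s : ℝ) : ℂ) * (2 * Complex.I) := by
      push_cast at h0 ⊢
      linear_combination h0
    rcases hs0.eq_or_lt with hs2 | hs2
    · rw [← hs2] at h1
      have h2 : z - 2 * Complex.I = 0 := by
        push_cast at h1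
        linear_combination h1
      rw [h2, norm_zero] at hp
      linarith
    · have hn : ‖z‖ = 3 + s := by
        rcases max_choice 0 (‖z‖ - 3) with h | h
        · rw [hs, outerCutoff, h] at hs2
          exact absurd hs2 (lt_irrefl _)
        · rw [hs, outerCutoff, h]
          ring
      -- This gives $(1-\tfrac34 s)(3+s)=2(1-s)$, but the left side is larger on $[0,1]$.
      have h2 := congrArg norm h1
      rw [norm_mul, norm_mul, Complex.norm_of_nonneg (by linarith),
        Complex.norm_of_nonneg (by linarith), norm_two_mul_I, hn] at h2
      nlinarith
  · have htn : t = 2 - ‖z - -2 * Complex.I‖ := by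
      rcases max_choice 0 (2 - ‖z - -2 * Complex.I‖) with h | h
      · rw [ht, innerCutoff, h] at ht2
        exact absurd ht2 (lt_irrefl _)
      · rw [ht, innerCutoff, h]
    have him : z.im < 0 := by
      have h := (abs_le.1 (Complex.abs_im_le_norm (z - -2 * Complex.I))).2
      rw [Complex.sub_im, neg_two_mul_I_im] at h
      linarith
    have hst : s + t ≤ 1 := by
      rcases max_choice 0 (‖z‖ - 3) with h | h
      · rw [hs, outerCutoff, h]
        linarith
      · have h' := norm_sub_norm_le z (-2 * Complex.I)
        rw [norm_neg_two_mul_I] at h'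
        rw [hs, outerCutoff, h, htn]
        linarith
    have h1 : windPants z = (s / 4 : ℝ) * z - (t : ℝ) + (1 - s - t : ℝ) * (z - 2 * Complex.I) := by
      rw [windPants, ← hs, ← ht]
      push_cast
      ring
    -- Both terms of $\tfrac s4\,\mathrm{Im}\,z+(1-s-t)(\mathrm{Im}\,z-2)=0$ are nonpositive, so
    -- $s=0$ and $t=1$. The value is then $-1$.
    have h2 := congrArg Complex.im (h1.symm.trans h0)
    simp only [Complex.add_im, Complex.sub_im, Complex.im_ofReal_mul, Complex.ofReal_im,
      two_mul_I_im, Complex.zero_im] at h2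
    have hs2 : s = 0 := by nlinarith
    have ht3 : t = 1 := by
      rw [hs2] at h2 hst
      nlinarith
    rw [h1, hs2, ht3] at h0
    simp at h0

theorem attachPoint_of_outer (n : ℕ+) {z : ℂ} (hz : z ∈ Metric.sphere (0 : ℂ) 4) :
    attachPoint n z = toCircle 0 4 n z := by
  rw [attachPoint, if_pos hz]

theorem attachPoint_of_inner_one (n : ℕ+) {z : ℂ} (hz : z ∈ Metric.sphere (2 * Complex.I) 1) :
    attachPoint n z = toCircle (2 * Complex.I) 1 (2 * n) z := by
  rw [attachPoint, if_neg (not_mem_of_norm_sub norm_two_mul_I hz), if_pos hz]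

theorem attachPoint_of_inner_two (n : ℕ+) {z : ℂ} (hz : z ∈ Metric.sphere (-2 * Complex.I) 1) :
    attachPoint n z = toCircle (-2 * Complex.I) 1 (2 * n + 1) z := by
  rw [attachPoint, if_neg (not_mem_of_norm_sub norm_neg_two_mul_I hz), if_neg]
  intro h
  have h1 := windPants_of_inner_one h
  rw [windPants_of_inner_two hz] at h1
  have hz1 : z = -1 + 2 * Complex.I := by linear_combination -h1
  have h2 := (abs_le.1 (Complex.abs_im_le_norm (z - -2 * Complex.I))).2
  rw [mem_sphere_iff_norm.1 hz, Complex.sub_im, neg_two_mul_I_im, hz1, Complex.add_im,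
    two_mul_I_im] at h2
  norm_num at h2

theorem continuous_toCircle (c : ℂ) (r : ℝ) (m : ℕ+) : Continuous (toCircle c r m) := by
  unfold toCircle
  fun_prop

open Classical in
/-- The map on the pair of pants `P_n` which is compatible with `windEarring`. -/
noncomputable def windPiece (n : ℕ+) (z : ℂ) : ℂ :=
  if ∃ j : ℕ, (n : ℕ) = 2 ^ j then windPants z else -1

theorem continuous_windPiece (n : ℕ+) : Continuous (windPiece n) := by
  unfold windPiece
  split_ifs
  · exact continuous_windPants
  · exact continuous_const

theorem windPiece_ne_zero (n : ℕ+) (z : Pants) : windPiece n z ≠ 0 := by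
  unfold windPiece
  split_ifs
  · exact windPants_ne_zero z
  · simp

/-- The number $2n$ is a power of two exactly when $n$ is, and $2n+1\ge 3$ never is. The bound on
`n` keeps $2n$ among the powers up to $2^J$. -/
theorem windEarring_attachPoint {J : ℕ} {n : ℕ+} (hn : (n : ℕ) < 2 ^ J) {z : Pants}
    (hz : z ∈ pantsBoundary) : windEarring J (attachPoint n z) = windPiece n z := by
  have h2n : ((2 * n : ℕ+) : ℕ) = 2 * n := rfl
  have h2n1 : ((2 * n + 1 : ℕ+) : ℕ) = 2 * n + 1 := rfl
  have hodd (j : ℕ) (_ : j ≤ J) : ((2 * n + 1 : ℕ+) : ℕ) ≠ 2 ^ j := by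
    have := n.pos
    rw [h2n1]
    rcases j with _ | j
    · rw [pow_zero]
      omega
    · rw [pow_succ]
      omega
  by_cases h : ∃ j : ℕ, (n : ℕ) = 2 ^ j
  · rw [windPiece, if_pos h]
    obtain ⟨j, hj⟩ := h
    have hjJ : j < J := (Nat.pow_lt_pow_iff_right (by norm_num)).1 (hj ▸ hn)
    rcases hz with (hz | hz) | hz
    · rw [attachPoint_of_outer n hz, windPants_of_outer hz]
      have := windEarring_toCircle_pow hjJ.le (by norm_num : (0 : ℝ) < 4) hj hz
      simpa using this
    · rw [attachPoint_of_inner_one n hz, windPants_of_inner_one hz]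
      have := windEarring_toCircle_pow (J := J) (j := j + 1) hjJ (by norm_num : (0 : ℝ) < 1)
        (m := 2 * n) (by rw [h2n, hj, pow_succ']) hz
      simpa using this
    · rw [attachPoint_of_inner_two n hz, windPants_of_inner_two hz]
      exact windEarring_toCircle_of_ne (by norm_num) hodd hz
  · rw [windPiece, if_neg h]
    push Not at h
    rcases hz with (hz | hz) | hz
    · rw [attachPoint_of_outer n hz]
      exact windEarring_toCircle_of_ne (by norm_num) (fun j _ ↦ h j) hz
    · rw [attachPoint_of_inner_one n hz]
      refine windEarring_toCircle_of_ne (by norm_num) (fun j _ h' ↦ ?_) hz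
      rw [h2n] at h'
      rcases j with _ | j
      · rw [pow_zero] at h'
        omega
      · rw [pow_succ'] at h'
        exact h j (by omega)
    · rw [attachPoint_of_inner_two n hz]
      exact windEarring_toCircle_of_ne (by norm_num) hodd hz

/-! ### Compact subsets of the Hawaiian Pants -/

open Classical in
/-- The coordinate of a point in the interior of a pair of pants. -/
noncomputable def interiorCoord : HPants → Option (Σ _ : ℕ+, Pants) :=
  Quot.lift (Sum.elim (fun _ ↦ none) fun p ↦ if p ∈ coprodBoundary then none else some p) (by
    rintro p q ⟨a, rfl, rfl⟩
    exact if_pos a.2)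

theorem interiorCoord_incl (y : Earring) : interiorCoord (incl y) = none := rfl

theorem interiorCoord_pantsMap_of_mem (n : ℕ+) {z : Pants} (hz : z ∈ pantsBoundary) :
    interiorCoord (pantsMap n z) = none := if_pos hz

theorem interiorCoord_pantsMap_of_notMem (n : ℕ+) {z : Pants} (hz : z ∉ pantsBoundary) :
    interiorCoord (pantsMap n z) = some ⟨n, z⟩ := if_neg hz

theorem isOpen_iff (U : Set HPants) :
    IsOpen U ↔ IsOpen (incl ⁻¹' U) ∧ ∀ n, IsOpen (pantsMap n ⁻¹' U) := by
  have h : IsOpen U ↔ IsOpen (Quot.mk _ ⁻¹' U : Set (Earring ⊕ Σ _ : ℕ+, Pants)) :=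
    (isQuotientMap_quot_mk.isOpen_preimage).symm
  rw [h, isOpen_sum_iff, isOpen_sigma_iff]
  rfl

theorem isClosed_iff (U : Set HPants) :
    IsClosed U ↔ IsClosed (incl ⁻¹' U) ∧ ∀ n, IsClosed (pantsMap n ⁻¹' U) := by
  simp only [← isOpen_compl_iff, isOpen_iff, Set.preimage_compl]

theorem hpants_ind {P : HPants → Prop} (hincl : ∀ y, P (incl y))
    (hpants : ∀ n, ∀ z ∉ pantsBoundary, P (pantsMap n z)) (x : HPants) : P x := by
  obtain ⟨y | ⟨n, z⟩, rfl⟩ := Quot.exists_rep x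
  · exact hincl y
  · by_cases hz : z ∈ pantsBoundary
    · have := pantsMap_boundary n z hz (y := attach n ⟨z, hz⟩) rfl
      change P (pantsMap n z)
      rw [this]
      exact hincl _
    · exact hpants n z hz

/-- The part of the Hawaiian Pants that contains only the pairs of pants `P_n` with `n < N`. -/
def truncation (N : ℕ) : Set HPants := {x | ∀ p, interiorCoord x = some p → (p.1 : ℕ) < N}

/-- A compact subset of the Hawaiian Pants meets the interiors of only finitely many pairs of
pants. -/
theorem exists_subset_truncation {K : Set HPants} (hK : IsCompact K) :
    ∃ N, ∀ N' ≥ N, K ⊆ truncation N' := by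
  set T : Set ℕ+ := {n | ∃ z, z ∉ pantsBoundary ∧ pantsMap n z ∈ K}
  have : Nonempty Pants := ⟨outerPoint 0⟩
  have hT : ∀ n ∈ T, ∃ z, z ∉ pantsBoundary ∧ pantsMap n z ∈ K := fun _ h ↦ h
  choose! z hz hzK using hT
  -- One chosen point of `K` in each interior that it meets. `U m` omits those of index at least
  -- `m`; it is open since at most one point is removed from each pair of pants. If `K` lies in `U
  -- m`, no index at least `m` is in `T`.
  let U : ℕ → Set HPants := fun m ↦ {x | ∀ n : ℕ+, m ≤ n → n ∈ T → interiorCoord x ≠ some ⟨n, z n⟩}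
  have hU (m : ℕ) : IsOpen (U m) := by
    refine (isOpen_iff _).2 ⟨?_, fun n ↦ ?_⟩
    · convert isOpen_univ
      ext y
      simp [U, interiorCoord_incl]
    · rw [← isClosed_compl_iff]
      refine Set.Finite.isClosed ((Set.finite_singleton (z n)).subset fun w hw ↦ ?_)
      simp only [U, Set.mem_compl_iff, Set.mem_preimage, Set.mem_ofPred_eq, not_forall,
        not_not] at hw
      obtain ⟨n', -, -, h⟩ := hw
      by_cases hw : w ∈ pantsBoundary
      · simp [interiorCoord_pantsMap_of_mem n hw] at h
      · rw [interiorCoord_pantsMap_of_notMem n hw, Option.some_inj] at h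
        cases h
        rfl
  have hmono : Monotone U := fun a b hab x hx n hn ↦ hx n (hab.trans hn)
  have hcover : K ⊆ ⋃ m, U m := fun x _ ↦ by
    refine Set.mem_iUnion.2 ?_
    cases hx : interiorCoord x with
    | none => exact ⟨0, fun n _ _ ↦ by simp [hx]⟩
    | some p =>
      refine ⟨p.1 + 1, fun n hn _ h ↦ ?_⟩
      rw [hx, Option.some_inj] at h
      subst h
      exact absurd hn (by simp)
  obtain ⟨m, hm⟩ := hK.elim_directed_cover U hU hcover hmono.directed_le
  refine ⟨m, fun N' hN' x hx p hp ↦ ?_⟩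
  by_contra hlt
  have hpT : p.1 ∈ T := by
    revert hx hp
    refine hpants_ind (P := fun x ↦ x ∈ K → interiorCoord x = some p → p.1 ∈ T) ?_ ?_ x
    · intro y _ h
      simp [interiorCoord_incl] at h
    · intro n w hw hwK h
      rw [interiorCoord_pantsMap_of_notMem n hw, Option.some_inj] at h
      subst h
      exact ⟨w, hw, hwK⟩
  exact hm (hzK _ hpT) p.1 (by omega) hpT (interiorCoord_pantsMap_of_notMem _ (hz _ hpT))

/-! ### A map from a truncation of the Hawaiian Pants to the punctured plane -/

open Classical in
/-- A map on the Hawaiian Pants that winds `ℓ_1` once around the origin. It is continuous on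
`truncation (2 ^ J)`. -/
noncomputable def windHPants (J : ℕ) : HPants → ℂ :=
  Quot.lift (Sum.elim (fun y ↦ windEarring J y) fun p ↦
    if p ∈ coprodBoundary then windEarring J (attachPoint p.1 p.2) else windPiece p.1 p.2) (by
    rintro p q ⟨a, rfl, rfl⟩
    exact if_pos a.2)

theorem windHPants_incl (J : ℕ) (y : Earring) : windHPants J (incl y) = windEarring J y := rfl

theorem windHPants_pantsMap_of_mem (J : ℕ) (n : ℕ+) {z : Pants} (hz : z ∈ pantsBoundary) :
    windHPants J (pantsMap n z) = windEarring J (attachPoint n z) := if_pos hz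

theorem windHPants_pantsMap_of_notMem (J : ℕ) (n : ℕ+) {z : Pants} (hz : z ∉ pantsBoundary) :
    windHPants J (pantsMap n z) = windPiece n z := if_neg hz

theorem windHPants_pantsMap {J : ℕ} {n : ℕ+} (hn : (n : ℕ) < 2 ^ J) (z : Pants) :
    windHPants J (pantsMap n z) = windPiece n z := by
  by_cases hz : z ∈ pantsBoundary
  · rw [windHPants_pantsMap_of_mem J n hz, windEarring_attachPoint hn hz]
  · exact windHPants_pantsMap_of_notMem J n hz

theorem windHPants_ne_zero (J : ℕ) (x : HPants) : windHPants J x ≠ 0 := by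
  refine hpants_ind (P := fun x ↦ windHPants J x ≠ 0) (fun y ↦ windEarring_ne_zero J y.2) (fun n z hz ↦ ?_) x
  rw [windHPants_pantsMap_of_notMem J n hz]
  exact windPiece_ne_zero n z

/-- The attaching map is defined by cases; on each of the three closed boundary circles it is a
similarity. -/
theorem isClosed_boundary_preimage (J : ℕ) (n : ℕ+) {t : Set ℂ} (ht : IsClosed t) :
    IsClosed {z : Pants | z ∈ pantsBoundary ∧ windEarring J (attachPoint n z) ∈ t} := by
  have hcl (c : ℂ) (r : ℝ) (m : ℕ+) : IsClosed
      {z : Pants | (z : ℂ) ∈ Metric.sphere c r ∧ windEarring J (toCircle c r m z) ∈ t} :=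
    (Metric.isClosed_sphere.preimage continuous_subtype_val).inter
      (ht.preimage ((continuous_windEarring J).comp
        ((continuous_toCircle c r m).comp continuous_subtype_val)))
  convert ((hcl 0 4 n).union (hcl (2 * Complex.I) 1 (2 * n))).union
    (hcl (-2 * Complex.I) 1 (2 * n + 1)) using 1
  ext z
  constructor
  · rintro ⟨(hz | hz) | hz, h⟩
    · exact Or.inl (Or.inl ⟨hz, attachPoint_of_outer n hz ▸ h⟩)
    · exact Or.inl (Or.inr ⟨hz, attachPoint_of_inner_one n hz ▸ h⟩)
    · exact Or.inr ⟨hz, attachPoint_of_inner_two n hz ▸ h⟩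
  · rintro ((⟨hz, h⟩ | ⟨hz, h⟩) | ⟨hz, h⟩)
    · exact ⟨Or.inl (Or.inl hz), (attachPoint_of_outer n hz).symm ▸ h⟩
    · exact ⟨Or.inl (Or.inr hz), (attachPoint_of_inner_one n hz).symm ▸ h⟩
    · exact ⟨Or.inr hz, (attachPoint_of_inner_two n hz).symm ▸ h⟩

/-- Closed sets are tested on each piece: for $n<2^J$ all of $P_n$ takes part, for larger $n$ only
its boundary. -/
theorem continuousOn_windHPants (J : ℕ) : ContinuousOn (windHPants J) (truncation (2 ^ J)) := by
  refine continuousOn_iff_isClosed.2 fun t ht ↦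
    ⟨windHPants J ⁻¹' t ∩ truncation (2 ^ J), (isClosed_iff _).2 ⟨?_, fun n ↦ ?_⟩, by
      rw [Set.inter_assoc, Set.inter_self]⟩
  · convert ht.preimage ((continuous_windEarring J).comp continuous_subtype_val) using 1
    ext y
    simp [truncation, interiorCoord_incl, windHPants_incl]
  · by_cases hn : (n : ℕ) < 2 ^ J
    · convert ht.preimage ((continuous_windPiece n).comp continuous_subtype_val) using 1
      ext z
      have : pantsMap n z ∈ truncation (2 ^ J) := fun p hp ↦ by
        by_cases hz : z ∈ pantsBoundary
        · simp [interiorCoord_pantsMap_of_mem n hz] at hp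
        · rw [interiorCoord_pantsMap_of_notMem n hz, Option.some_inj] at hp
          exact hp ▸ hn
      simp [this, windHPants_pantsMap hn]
    · convert isClosed_boundary_preimage J n ht using 1
      ext z
      by_cases hz : z ∈ pantsBoundary
      · simp [hz, truncation, interiorCoord_pantsMap_of_mem n hz,
          windHPants_pantsMap_of_mem J n hz]
      · simp [hz, truncation, interiorCoord_pantsMap_of_notMem n hz, not_lt.1 hn]

/-! ### The loop `ℓ_1` is not null-homotopic -/

theorem windHPants_pantsLoop (J : ℕ) (t : I) :
    windHPants J (pantsLoop 1 t) = -Complex.exp (-(2 * Real.pi * (t : ℝ) * Complex.I)) := by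
  change windEarring J (loopPoint 1 t) = _
  have h := dyadicBump_pow (Nat.zero_le J)
  rw [pow_zero] at h
  rw [windEarring_of_mem_circle J (loopPoint_mem_circle 1 t), loopPoint, PNat.one_coe, h]
  simp only [Nat.cast_one, Complex.ofReal_one, div_one, one_mul]
  ring

theorem pantsLoop_one_not_homotopic_refl : ¬ (pantsLoop 1).Homotopic (Path.refl base) := by
  rintro ⟨H⟩
  obtain ⟨N, hN⟩ := exists_subset_truncation (isCompact_range H.continuous)
  have hsub := hN (2 ^ N) Nat.lt_two_pow_self.le
  -- The sign and the inverse turn $-e^{-2\pi i t}$, the image of $\ell_1$, into the standard loop.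
  let Φ : HPants → Circle := fun x ↦
    (normalize ⟨-windHPants N x, neg_ne_zero.2 (windHPants_ne_zero N x)⟩)⁻¹
  have hΦ : Continuous fun p : I × I ↦ Φ (H p) := by
    have : Continuous fun p : I × I ↦ windHPants N (H p) :=
      (continuousOn_windHPants N).comp_continuous H.continuous fun p ↦ hsub ⟨p, rfl⟩
    exact (normalize.continuous.comp (this.neg.subtype_mk
      fun p ↦ neg_ne_zero.2 (windHPants_ne_zero N (H p)))).inv
  have hloop (t : I) : Φ (pantsLoop 1 t) = Circle.stdLoop t := by
    apply inv_injective
    rw [inv_inv]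
    apply Circle.ext
    change _ = (((Circle.exp (2 * Real.pi * t))⁻¹ : Circle) : ℂ)
    rw [coe_normalize, ← Circle.exp_neg, Circle.coe_exp]
    simp only [windHPants_pantsLoop, neg_neg, norm_exp_turn]
    push_cast
    simp
  have hbase : Φ base = 1 := by
    have := hloop 0
    rwa [Path.source, Path.source] at this
  refine Circle.stdLoop_not_homotopic_refl ⟨
    { toFun := fun p ↦ Φ (H p)
      continuous_toFun := hΦ
      map_zero_left := fun t ↦ by
        rw [H.apply_zero]
        exact hloop t
      map_one_left := fun t ↦ by
        rw [H.apply_one]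
        exact hbase
      prop' := fun s t ht ↦ ?_ }⟩
  rcases ht with rfl | rfl
  · change Φ (H (s, 0)) = Circle.stdLoop 0
    rw [H.source, hbase, Path.source]
  · change Φ (H (s, 1)) = Circle.stdLoop 1
    rw [H.target, hbase, Path.target]

theorem loopClass_pantsLoop_one_ne_one : loopClass (pantsLoop 1) ≠ 1 := fun h ↦
  pantsLoop_one_not_homotopic_refl (Path.Homotopic.Quotient.eq.1 h)

end HawaiianPants

theorem mainTheorem10 :
    HawaiianPants.loopClass (HawaiianPants.pantsLoop 1) ≠ 1 ∧
    (∀ (S : Type u) [Group S], HawaiianPants.IsNSlender S →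
      ∀ h : FundamentalGroup HawaiianPants.HPants HawaiianPants.base →* S,
        h (HawaiianPants.loopClass (HawaiianPants.pantsLoop 1)) = 1) ∧
    ¬ HawaiianPants.IsResiduallyNSlender.{u, 0}
        (FundamentalGroup HawaiianPants.HPants HawaiianPants.base) ∧
    ¬ HawaiianPants.IsResiduallyFree.{u, 0}
        (FundamentalGroup HawaiianPants.HPants HawaiianPants.base) := by
  refine ⟨HawaiianPants.loopClass_pantsLoop_one_ne_one,
    fun S _ hS h ↦ HawaiianPants.map_pantsLoop_eq_one_of_isNSlender hS h 1, fun hres ↦ ?_,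
    fun hres ↦ ?_⟩
  · obtain ⟨S, _, hS, h, hh⟩ := hres _ HawaiianPants.loopClass_pantsLoop_one_ne_one
    exact hh (HawaiianPants.map_pantsLoop_eq_one_of_isNSlender hS h 1)
  · obtain ⟨S, _, _, h, hh⟩ := hres _ HawaiianPants.loopClass_pantsLoop_one_ne_one
    exact hh (HawaiianPants.map_pantsLoop_eq_one_of_isFreeGroup h 1)
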